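/- Let $n\ge 0$ and let $\omega_1,\dots,\omega_n\in\mathbb R$ be non-resonant, i.e. linearly independent over $\mathbb Q$ (no nontrivial relation $\sum_j k_j\omega_j=0$ with $k_j\in\mathbb Z$; this holds in particular if $\omega_1,\dots,\omega_n$ are algebraically independent over $\mathbb Q$). On $\mathbb R^2\times\mathbb C^n\cong\mathbb R^{2n+2}$, with coordinates $(x_1,x_2,z_1,\dots,z_n)$, let $a_0,\dots,a_n\in\{1,-1\}$ and consider the commuting linear involutions $$\phi(x_1,x_2,z)=(x_1,-x_2,\bar z_1,\dots,\bar z_n),\qquad \psi(x_1,x_2,z)=(a_0x_1,-a_0x_2,a_1\bar z_1,\dots,a_n\bar z_n).$$ Let $X$ be a $C^\infty$ vector field on $\mathbb R^2\times\mathbb C^n$ which is bireversible, $X\circ\phi=-\phi\circ X$ and $X\circ\psi=-\psi\circ X$, with $X(0)=0$ and linear part $dX(0)(x_1,x_2,z)=(x_2,0,-i\omega_1z_1,\dots,-i\omega_nz_n)$. Two vector fields $X,Y$ vanishing at $0$ are called formally conjugate if their Taylor series $\hat X,\hat Y$ at $0$ satisfy $D\Phi\cdot\hat X=\hat Y\circ\Phi$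 for some formal change of coordinates $\Phi=I+(\text{terms of degree}\ge 2)$. (a) If $a_0=1$ (in particular if $\phi=\psi$), there are $C^\infty$ functions $f_0,\dots,f_n:\mathbb R^{n+1}\to\mathbb R$ such that $\dot p=X(p)$ is formally conjugate to $$\dot x_1=x_2,\quad \dot x_2=f_0(x_1,|z_1|^2,\dots,|z_n|^2),\quad \dot z_j=-i\omega_jz_j+iz_jf_j(x_1,|z_1|^2,\dots,|z_n|^2)\quad(1\le j\le n).$$ (b) If $a_0=-1$, there are $C^\infty$ functions $f_0,\dots,f_n:\mathbb R^{n+1}\to\mathbb R$ such that $\dot p=X(p)$ is formally conjugate to $$\dot x_1=x_2,\quad \dot x_2=x_1f_0(x_1^2,|z_1|^2,\dots,|z_n|^2),\quad \dot z_j=-i\omega_jz_j+iz_jf_j(x_1^2,|z_1|^2,\dots,|z_n|^2)\quad(1\le j\le n).$$ In both cases the normal form vanishes at $0$, has the same linear part as $X$, and is reversible under both $\phi$ and $\psi$. -/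

import Mathlib

open scoped Nat

noncomputable section

namespace Bireversible

/-- The phase space `ℝ² × ℂⁿ`, identified with `ℝ^{2n+2}`. -/
abbrev Phase (n : ℕ) : Type := (ℝ × ℝ) × (Fin n → ℂ)

/-- The linear vector field with matrix
`diag ((0 1; 0 0), (0 ω₁; -ω₁ 0), …, (0 ωₙ; -ωₙ 0))`, in the coordinates `z_j = u_j + i v_j`:
`(x₁, x₂, z) ↦ (x₂, 0, -i ω₁ z₁, …, -i ωₙ zₙ)`. -/
def linearField {n : ℕ} (ω : Fin n → ℝ) (p : Phase n) : Phase n :=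
  ((p.1.2, 0), fun j => -Complex.I * (ω j : ℂ) * p.2 j)

/-- The involution `(x₁, x₂, z) ↦ (a₀ x₁, -a₀ x₂, a₁ z̄₁, …, aₙ z̄ₙ)`, for signs `a₀, …, aₙ`. -/
def psi {n : ℕ} (a₀ : ℝ) (a : Fin n → ℝ) (p : Phase n) : Phase n :=
  ((a₀ * p.1.1, -a₀ * p.1.2), fun j => (a j : ℂ) * (starRingEnd ℂ) (p.2 j))

/-- The involution `(x₁, x₂, z) ↦ (x₁, -x₂, z̄₁, …, z̄ₙ)`. -/
def phi {n : ℕ} (p : Phase n) : Phase n :=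
  ((p.1.1, -p.1.2), fun j => (starRingEnd ℂ) (p.2 j))

/-- `X` is a smooth vector field on `ℝ² × ℂⁿ` that vanishes at the origin, has the linear part
`linearField ω` there, and is reversible under both involutions `phi` and `psi a₀ a`. -/
structure IsBireversibleSystem {n : ℕ} (ω : Fin n → ℝ) (a₀ : ℝ) (a : Fin n → ℝ)
    (X : Phase n → Phase n) : Prop where
  smooth : ContDiff ℝ (⊤ : ℕ∞) X
  equilibrium : X 0 = 0
  linear_part : ∀ p : Phase n, fderiv ℝ X 0 p = linearField ω p
  reversible_phi : ∀ p : Phase n, X (phi p) = -phi (X p)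
  reversible_psi : ∀ p : Phase n, X (psi a₀ a p) = -psi a₀ a (X p)

/-- Labels of the `2n + 2` real coordinates: `inl 0`, `inl 1` stand for `x₁`, `x₂`, and
`inr (inl j)`, `inr (inr j)` for the real and the imaginary part of `z_j`. -/
abbrev Coord (n : ℕ) : Type := Fin 2 ⊕ (Fin n ⊕ Fin n)

/-- The value of a real coordinate at a point. -/
def coord {n : ℕ} : Coord n → Phase n → ℝ
  | .inl i, p => if i = 0 then p.1.1 else p.1.2
  | .inr (.inl j), p => (p.2 j).re
  | .inr (.inr j), p => (p.2 j).im

/-- The unit vector in the direction of a real coordinate. -/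
def unitVec {n : ℕ} : Coord n → Phase n
  | .inl i => (if i = 0 then (1, 0) else (0, 1), 0)
  | .inr (.inl j) => ((0, 0), Pi.single j 1)
  | .inr (.inr j) => ((0, 0), Pi.single j Complex.I)

theorem coord_unitVec {n : ℕ} (c d : Coord n) :
    coord c (unitVec d) = if c = d then 1 else 0 := by
  rcases c with c | c | c <;> rcases d with d | d | d
  · fin_cases c <;> fin_cases d <;> simp [coord, unitVec]
  · simp [coord, unitVec]
  · simp [coord, unitVec]
  · simp [coord, unitVec]
  · by_cases h : c = d <;> simp [coord, unitVec, h]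
  · by_cases h : c = d <;> simp [coord, unitVec, h]
  · simp [coord, unitVec]
  · by_cases h : c = d <;> simp [coord, unitVec, h]
  · by_cases h : c = d <;> simp [coord, unitVec, h]

/-- The Taylor series at the origin of a smooth function on `ℝ² × ℂⁿ`, as a formal power series in
the real coordinates: the coefficient at the multi-index `m` is `∂^m f (0) / m!`. The multi-index
is written out as the list of the coordinates to differentiate in, each repeated `m c` times
(the order is irrelevant for smooth `f`). -/
def taylorSeries {n : ℕ} (f : Phase n → ℝ) : MvPowerSeries (Coord n) ℝ := fun m =>
  (∏ c, ((m c)! : ℝ))⁻¹ *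
    iteratedFDeriv ℝ (Finsupp.toMultiset m).toList.length f 0
      (fun k => unitVec ((Finsupp.toMultiset m).toList.get k))

/-- The formal vector field given by the Taylor series at the origin of the components of `X`. -/
def formalField {n : ℕ} (X : Phase n → Phase n) (c : Coord n) : MvPowerSeries (Coord n) ℝ :=
  taylorSeries fun p => coord c (X p)

/-- A formal change of coordinates tangent to the identity, `Φ = I + (terms of degree ≥ 2)`. -/
structure IsFormalNearIdentity {n : ℕ} (Φ : Coord n → MvPowerSeries (Coord n) ℝ) : Prop where
  const_coeff : ∀ c, MvPowerSeries.constantCoeff (Φ c) = 0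
  linear_coeff : ∀ c d, MvPowerSeries.coeff (Finsupp.single d 1) (Φ c) = if c = d then 1 else 0

/-- Two smooth vector fields vanishing at the origin are formally conjugate: their Taylor series
`X̂`, `Ŷ` are conjugate as formal vector fields, `DΦ · X̂ = Ŷ ∘ Φ`, by a formal change of
coordinates `Φ` tangent to the identity. -/
def FormallyConjugate {n : ℕ} (X Y : Phase n → Phase n) : Prop :=
  ∃ Φ : Coord n → MvPowerSeries (Coord n) ℝ, IsFormalNearIdentity Φ ∧
    ∀ c, ∑ d, MvPowerSeries.pderiv ℝ d (Φ c) * formalField X d =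
      MvPowerSeries.subst Φ (formalField Y c)

/-- The substitution in `FormallyConjugate` is a genuine one. -/
theorem IsFormalNearIdentity.hasSubst {n : ℕ} {Φ : Coord n → MvPowerSeries (Coord n) ℝ}
    (h : IsFormalNearIdentity Φ) : MvPowerSeries.HasSubst Φ :=
  MvPowerSeries.hasSubst_of_constantCoeff_zero h.const_coeff

/-- The system `ẋ₁ = x₂`, `ẋ₂ = f₀(x₁, |z₁|², …, |zₙ|²)`,
`ż_j = -i ω_j z_j + i z_j f_j(x₁, |z₁|², …, |zₙ|²)`. -/
def normalFormPos {n : ℕ} (ω : Fin n → ℝ) (f₀ : ℝ × (Fin n → ℝ) → ℝ)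
    (f : Fin n → ℝ × (Fin n → ℝ) → ℝ) (p : Phase n) : Phase n :=
  ((p.1.2, f₀ (p.1.1, fun k => ‖p.2 k‖ ^ 2)),
    fun j => -Complex.I * (ω j : ℂ) * p.2 j
      + Complex.I * p.2 j * (f j (p.1.1, fun k => ‖p.2 k‖ ^ 2) : ℂ))

/-- The system `ẋ₁ = x₂`, `ẋ₂ = x₁ f₀(x₁², |z₁|², …, |zₙ|²)`,
`ż_j = -i ω_j z_j + i z_j f_j(x₁², |z₁|², …, |zₙ|²)`. -/
def normalFormNeg {n : ℕ} (ω : Fin n → ℝ) (f₀ : ℝ × (Fin n → ℝ) → ℝ)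
    (f : Fin n → ℝ × (Fin n → ℝ) → ℝ) (p : Phase n) : Phase n :=
  ((p.1.2, p.1.1 * f₀ (p.1.1 ^ 2, fun k => ‖p.2 k‖ ^ 2)),
    fun j => -Complex.I * (ω j : ℂ) * p.2 j
      + Complex.I * p.2 j * (f j (p.1.1 ^ 2, fun k => ‖p.2 k‖ ^ 2) : ℂ))

end Bireversible

end

noncomputable section

namespace Bireversible

open MvPowerSeries

section FormalSeries

variable {σ τ R : Type*} [CommRing R]

/-- The ideal of power series without terms of degree less than `k`. -/
def ordIdeal (σ R : Type*) [CommRing R] (k : ℕ) : Ideal (MvPowerSeries σ R) where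
  carrier := {f | (k : ℕ∞) ≤ f.order}
  add_mem' hf hg := le_trans (le_min hf hg) min_order_le_add
  zero_mem' := by simp
  smul_mem' c f hf := le_trans hf (le_trans le_add_self le_order_mul)

theorem mem_ordIdeal {k : ℕ} {f : MvPowerSeries σ R} :
    f ∈ ordIdeal σ R k ↔ ∀ m : σ →₀ ℕ, m.degree < k → coeff m f = 0 :=
  ⟨fun h m hm => coeff_of_lt_order (lt_of_lt_of_le (by exact_mod_cast hm) h),
    fun h => nat_le_order h⟩

theorem ordIdeal_anti {j k : ℕ} (h : j ≤ k) : ordIdeal σ R k ≤ ordIdeal σ R j :=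
  fun f (hf : (k : ℕ∞) ≤ f.order) => le_trans (by exact_mod_cast h : (j : ℕ∞) ≤ k) hf

theorem mem_ordIdeal_zero (f : MvPowerSeries σ R) : f ∈ ordIdeal σ R 0 := by
  simp [mem_ordIdeal]

theorem mul_mem_ordIdeal {j k : ℕ} {f g : MvPowerSeries σ R} (hf : f ∈ ordIdeal σ R j)
    (hg : g ∈ ordIdeal σ R k) : f * g ∈ ordIdeal σ R (j + k) := by
  refine le_trans ?_ le_order_mul
  push_cast
  exact add_le_add hf hg

theorem mem_ordIdeal_one {f : MvPowerSeries σ R} :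
    f ∈ ordIdeal σ R 1 ↔ constantCoeff f = 0 := by
  rw [mem_ordIdeal]
  constructor
  · intro h
    simpa using h 0 (by simp)
  · intro h m hm
    have : m = 0 := by
      rw [← Finsupp.degree_eq_zero_iff]; omega
    simpa [this] using h

theorem eq_zero_of_forall_mem_ordIdeal {f : MvPowerSeries σ R}
    (h : ∀ k, f ∈ ordIdeal σ R k) : f = 0 := by
  ext m
  exact mem_ordIdeal.1 (h (m.degree + 1)) m (Nat.lt_succ_self _)

theorem X_mem_ordIdeal (c : σ) : (X c : MvPowerSeries σ R) ∈ ordIdeal σ R 1 := by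
  simp [mem_ordIdeal_one]

theorem pderiv_mem_ordIdeal {k : ℕ} {f : MvPowerSeries σ R} (hf : f ∈ ordIdeal σ R (k + 1))
    (c : σ) : pderiv R c f ∈ ordIdeal σ R k := by
  rw [mem_ordIdeal] at *
  intro m hm
  rw [coeff_pderiv, hf _ (by simpa using hm), zero_mul]

/-- The monomial `m` evaluated at power series `a`. -/
def monoAt (a : σ → MvPowerSeries τ R) (m : σ →₀ ℕ) : MvPowerSeries τ R :=
  m.prod fun s e => a s ^ e

@[simp] theorem monoAt_zero (a : σ → MvPowerSeries τ R) : monoAt a 0 = 1 := by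
  simp [monoAt]

theorem monoAt_add (a : σ → MvPowerSeries τ R) (m m' : σ →₀ ℕ) :
    monoAt a (m + m') = monoAt a m * monoAt a m' := by
  classical
  exact Finsupp.prod_add_index' (by simp) (by intros; ring)

@[simp] theorem monoAt_single (a : σ → MvPowerSeries τ R) (c : σ) (k : ℕ) :
    monoAt a (Finsupp.single c k) = a c ^ k := by
  simp [monoAt]

theorem monoAt_mem_ordIdeal {a : σ → MvPowerSeries τ R} {w : σ → ℕ}
    (ha : ∀ c, a c ∈ ordIdeal τ R (w c)) (m : σ →₀ ℕ) :
    monoAt a m ∈ ordIdeal τ R (Finsupp.weight w m) := by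
  induction m using Finsupp.induction_linear with
  | zero => exact mem_ordIdeal_zero _
  | add f g hf hg => rw [monoAt_add, map_add]; exact mul_mem_ordIdeal hf hg
  | single c k =>
    rw [monoAt_single]
    induction k with
    | zero => simp [mem_ordIdeal_zero]
    | succ k ih =>
      rw [pow_succ, Finsupp.single_add, map_add]
      refine mul_mem_ordIdeal ih ?_
      simpa [Finsupp.weight_apply] using ha c

theorem monoAt_mem_ordIdeal_degree {a : σ → MvPowerSeries τ R}
    (ha : ∀ c, a c ∈ ordIdeal τ R 1) (m : σ →₀ ℕ) :
    monoAt a m ∈ ordIdeal τ R m.degree := by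
  have := monoAt_mem_ordIdeal (w := fun _ => 1) ha m
  rwa [show Finsupp.weight (fun _ => 1) m = m.degree by
    simp [Finsupp.weight_apply, Finsupp.degree_apply, Finsupp.sum]] at this

theorem monoAt_sub_mem {a b : σ → MvPowerSeries τ R} {q : ℕ}
    (ha : ∀ c, a c ∈ ordIdeal τ R 1) (hb : ∀ c, b c ∈ ordIdeal τ R 1)
    (hab : ∀ c, a c - b c ∈ ordIdeal τ R (q + 1)) (m : σ →₀ ℕ) :
    monoAt a m - monoAt b m ∈ ordIdeal τ R (m.degree + q) := by
  have key : ∀ (c : σ) (m : σ →₀ ℕ), monoAt a m - monoAt b m ∈ ordIdeal τ R (m.degree + q) →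
      monoAt a (m + Finsupp.single c 1) - monoAt b (m + Finsupp.single c 1) ∈
        ordIdeal τ R ((m + Finsupp.single c 1).degree + q) := by
    intro c m ih
    have : monoAt a (m + Finsupp.single c 1) - monoAt b (m + Finsupp.single c 1) =
        monoAt a m * (a c - b c) + (monoAt a m - monoAt b m) * b c := by
      rw [monoAt_add, monoAt_add, monoAt_single, monoAt_single]; ring
    rw [this]
    have e1 := mul_mem_ordIdeal (monoAt_mem_ordIdeal_degree ha m) (hab c)
    have e2 := mul_mem_ordIdeal ih (hb c)
    have d : (m + Finsupp.single c 1).degree + q = m.degree + (q + 1) := by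
      simp; ring
    rw [d]
    refine add_mem e1 ?_
    rwa [add_assoc] at e2
  have key2 : ∀ (c : σ) (k : ℕ) (m : σ →₀ ℕ),
      monoAt a m - monoAt b m ∈ ordIdeal τ R (m.degree + q) →
      monoAt a (m + Finsupp.single c k) - monoAt b (m + Finsupp.single c k) ∈
        ordIdeal τ R ((m + Finsupp.single c k).degree + q) := by
    intro c k
    induction k with
    | zero => intro m h; simpa using h
    | succ k ih =>
      intro m h
      rw [Finsupp.single_add, ← add_assoc]
      exact key c _ (ih m h)
  induction m using Finsupp.induction with
  | zero => simp
  | single_add c k f _ _ ih => rw [add_comm (Finsupp.single c k)]; exact key2 c k f ih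

theorem coeff_subst_eq_zero {a : σ → MvPowerSeries τ R} (ha : HasSubst a)
    {f : MvPowerSeries σ R} {e : τ →₀ ℕ}
    (h : ∀ d, coeff d f ≠ 0 → coeff e (monoAt a d) = 0) : coeff e (subst a f) = 0 := by
  rw [coeff_subst ha, finsum_eq_zero_of_forall_eq_zero]
  intro d
  by_cases hd : coeff d f = 0
  · simp [hd]
  · have := h d hd
    rw [monoAt] at this
    rw [this, smul_zero]

theorem subst_mem_ordIdeal_of_weight {a : σ → MvPowerSeries τ R} (ha : HasSubst a) {w : σ → ℕ}
    (haw : ∀ c, a c ∈ ordIdeal τ R (w c)) {f : MvPowerSeries σ R} {k : ℕ}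
    (hf : ∀ d, Finsupp.weight w d < k → coeff d f = 0) : subst a f ∈ ordIdeal τ R k := by
  rw [mem_ordIdeal]
  intro e he
  refine coeff_subst_eq_zero ha fun d hd => ?_
  have hk : k ≤ Finsupp.weight w d := by
    by_contra h
    exact hd (hf d (by omega))
  exact mem_ordIdeal.1 (monoAt_mem_ordIdeal haw d) e (by omega)

variable [Finite σ]

theorem hasSubst_of_mem_ordIdeal {a : σ → MvPowerSeries τ R} (ha : ∀ c, a c ∈ ordIdeal τ R 1) :
    HasSubst a :=
  hasSubst_of_constantCoeff_zero fun c => mem_ordIdeal_one.1 (ha c)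

theorem subst_mem_ordIdeal {a : σ → MvPowerSeries τ R} (ha : ∀ c, a c ∈ ordIdeal τ R 1)
    {f : MvPowerSeries σ R} {k : ℕ} (hf : f ∈ ordIdeal σ R k) : subst a f ∈ ordIdeal τ R k := by
  rw [mem_ordIdeal]
  intro e he
  refine coeff_subst_eq_zero (hasSubst_of_mem_ordIdeal ha) fun d hd => ?_
  have hk : k ≤ d.degree := by
    by_contra h
    exact hd (mem_ordIdeal.1 hf d (by omega))
  exact mem_ordIdeal.1 (monoAt_mem_ordIdeal_degree ha d) e (by omega)

theorem subst_sub_subst_mem {a b : σ → MvPowerSeries τ R} {p q : ℕ}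
    (ha : ∀ c, a c ∈ ordIdeal τ R 1) (hb : ∀ c, b c ∈ ordIdeal τ R 1)
    (hab : ∀ c, a c - b c ∈ ordIdeal τ R (q + 1)) {f : MvPowerSeries σ R}
    (hf : f ∈ ordIdeal σ R p) : subst a f - subst b f ∈ ordIdeal τ R (p + q) := by
  rw [mem_ordIdeal]
  intro e he
  have Ha := hasSubst_of_mem_ordIdeal ha
  have Hb := hasSubst_of_mem_ordIdeal hb
  rw [map_sub, coeff_subst Ha, coeff_subst Hb, ← finsum_sub_distrib
    (coeff_subst_finite Ha f e) (coeff_subst_finite Hb f e), finsum_eq_zero_of_forall_eq_zero]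
  intro d
  rw [← smul_sub, ← map_sub]
  by_cases hd : d.degree < p
  · rw [mem_ordIdeal.1 hf d hd, zero_smul]
  · have := mem_ordIdeal.1 (monoAt_sub_mem ha hb hab d) e (by omega)
    rw [monoAt, monoAt] at this
    rw [this, smul_zero]

theorem subst_sub_self_mem {b : σ → MvPowerSeries σ R} {p q : ℕ}
    (hb : ∀ c, b c - X c ∈ ordIdeal σ R (q + 1)) {f : MvPowerSeries σ R}
    (hf : f ∈ ordIdeal σ R p) : subst b f - f ∈ ordIdeal σ R (p + q) := by
  have hb1 : ∀ c, b c ∈ ordIdeal σ R 1 := fun c => by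
    have := add_mem (ordIdeal_anti (by omega : 1 ≤ q + 1) (hb c)) (X_mem_ordIdeal c)
    simpa using this
  have := subst_sub_subst_mem (a := b) (b := X) hb1 X_mem_ordIdeal hb hf
  rwa [subst_self, id] at this

end FormalSeries

section Signs

variable {σ τ R : Type*} [CommRing R]

theorem rescale_pderiv (ε : σ → R) (hε : ∀ c, ε c * ε c = 1) (c : σ) (f : MvPowerSeries σ R) :
    rescale ε (pderiv R c f) = C (ε c) * pderiv R c (rescale ε f) := by
  ext m
  rw [coeff_rescale, coeff_pderiv, coeff_C_mul, coeff_pderiv, coeff_rescale]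
  classical
  rw [Finsupp.prod_add_index' (by simp) (by intros; ring), Finsupp.prod_single_index (by simp),
    pow_one]
  linear_combination (-(m.prod fun s k => ε s ^ k) * coeff (m + Finsupp.single c 1) f * (m c + 1))
    * hε c

theorem rescale_subst [Finite σ] (ε : τ → R) {a : σ → MvPowerSeries τ R} (ha : HasSubst a)
    (f : MvPowerSeries σ R) :
    rescale ε (subst a f) = subst (fun c => rescale ε (a c)) f := by
  simp_rw [rescale_eq_subst]
  exact subst_comp_subst_apply ha (HasSubst.smul_X ε) f

theorem subst_rescale [Finite σ] (ε : σ → R) {a : σ → MvPowerSeries τ R} (ha : HasSubst a)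
    (f : MvPowerSeries σ R) :
    subst a (rescale ε f) = subst (fun c => C (ε c) * a c) f := by
  rw [rescale_eq_subst, subst_comp_subst_apply (HasSubst.smul_X ε) ha]
  congr 1
  funext c
  simp only [Pi.smul_apply']
  rw [subst_smul ha, subst_X ha, smul_eq_C_mul]

/-- The formal field `F` is equivariant (`s = 1`) or reversible (`s = -1`) under the linear
involution that multiplies the coordinate `c` by the sign `ε c`. -/
def SignSymm (ε : σ → R) (s : R) (F : σ → MvPowerSeries σ R) : Prop :=
  ∀ c, rescale ε (F c) = C (s * ε c) * F c

theorem SignSymm.add {ε : σ → R} {s : R} {F G : σ → MvPowerSeries σ R} (hF : SignSymm ε s F)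
    (hG : SignSymm ε s G) : SignSymm ε s (F + G) := fun c => by
  rw [Pi.add_apply, map_add, hF c, hG c]; ring

theorem SignSymm.neg {ε : σ → R} {s : R} {F : σ → MvPowerSeries σ R} (hF : SignSymm ε s F) :
    SignSymm ε s (-F) := fun c => by
  rw [Pi.neg_apply, map_neg, hF c]; ring

theorem SignSymm.sub {ε : σ → R} {s : R} {F G : σ → MvPowerSeries σ R} (hF : SignSymm ε s F)
    (hG : SignSymm ε s G) : SignSymm ε s (F - G) := by
  rw [sub_eq_add_neg]; exact hF.add hG.neg

/-- The derivative of the formal map `Φ` along the formal field `V`. -/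
def lieAlong [Fintype σ] (V Φ : σ → MvPowerSeries σ R) (c : σ) : MvPowerSeries σ R :=
  ∑ d, pderiv R d (Φ c) * V d

theorem rescale_lieAlong [Fintype σ] {ε : σ → R} (hε : ∀ c, ε c * ε c = 1) {s : R}
    {V : σ → MvPowerSeries σ R} (hV : SignSymm ε s V) (Φ : σ → MvPowerSeries σ R) (c : σ) :
    rescale ε (lieAlong V Φ c) = C s * lieAlong V (fun c => rescale ε (Φ c)) c := by
  rw [lieAlong, lieAlong, map_sum, Finset.mul_sum]
  refine Finset.sum_congr rfl fun d _ => ?_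
  rw [map_mul, rescale_pderiv ε hε, hV d, map_mul C]
  have : (C (ε d) * C (ε d) : MvPowerSeries σ R) = 1 := by rw [← map_mul, hε, map_one]
  linear_combination (pderiv R d (rescale ε (Φ c)) * C s * V d) * this

theorem SignSymm.lieAlong [Fintype σ] {ε : σ → R} (hε : ∀ c, ε c * ε c = 1) {s t : R}
    {V Φ : σ → MvPowerSeries σ R} (hV : SignSymm ε s V) (hΦ : SignSymm ε t Φ) :
    SignSymm ε (s * t) (lieAlong V Φ) := fun c => by
  rw [rescale_lieAlong hε hV]
  simp only [Bireversible.lieAlong, Finset.mul_sum]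
  refine Finset.sum_congr rfl fun d _ => ?_
  have : pderiv R d (C (t * ε c) * Φ c) = C (t * ε c) * pderiv R d (Φ c) := by
    rw [← smul_eq_C_mul, (pderiv R d).map_smul, smul_eq_C_mul]
  rw [hΦ c, this]
  simp only [map_mul]
  ring

theorem SignSymm.subst [Finite σ] {ε : σ → R} {s : R} {F Φ : σ → MvPowerSeries σ R}
    (hF : SignSymm ε s F) (hΦ : SignSymm ε 1 Φ) (h : HasSubst Φ) :
    SignSymm ε s (fun c => MvPowerSeries.subst Φ (F c)) := fun c => by
  have e : (fun c => rescale ε (Φ c)) = fun c => C (ε c) * Φ c := by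
    funext c; rw [hΦ c, one_mul]
  rw [rescale_subst ε h, e, ← subst_rescale ε h, hF c, ← smul_eq_C_mul, subst_smul h,
    smul_eq_C_mul]

end Signs

section Homogeneous

variable (σ R : Type*) [CommRing R]

/-- The homogeneous power series of degree `k`. -/
def homog (k : ℕ) : Submodule R (MvPowerSeries σ R) where
  carrier := {f | ∀ m : σ →₀ ℕ, m.degree ≠ k → coeff m f = 0}
  add_mem' hf hg m hm := by rw [map_add, hf m hm, hg m hm, add_zero]
  zero_mem' m _ := by simp
  smul_mem' c f hf m hm := by rw [map_smul, hf m hm, smul_zero]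

variable {σ R}

theorem homog_mul {j k : ℕ} {f g : MvPowerSeries σ R} (hf : f ∈ homog σ R j)
    (hg : g ∈ homog σ R k) : f * g ∈ homog σ R (j + k) := by
  classical
  intro m hm
  rw [coeff_mul]
  refine Finset.sum_eq_zero fun p hp => ?_
  rw [Finset.HasAntidiagonal.mem_antidiagonal] at hp
  by_cases h : p.1.degree = j
  · rw [hg p.2 (by rintro h2; apply hm; rw [← hp, map_add, h, h2]), mul_zero]
  · rw [hf p.1 h, zero_mul]

theorem homog_one : (1 : MvPowerSeries σ R) ∈ homog σ R 0 := by
  classical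
  intro m hm
  rw [coeff_one, if_neg]
  rintro rfl
  simp at hm

theorem homog_X (c : σ) : (X c : MvPowerSeries σ R) ∈ homog σ R 1 := by
  classical
  intro m hm
  rw [coeff_X, if_neg]
  rintro rfl
  simp at hm

theorem homog_C_mul (a : R) {k : ℕ} {f : MvPowerSeries σ R} (hf : f ∈ homog σ R k) :
    C a * f ∈ homog σ R k := by
  rw [← smul_eq_C_mul]; exact (homog σ R k).smul_mem a hf

theorem homog_pow {j : ℕ} {f : MvPowerSeries σ R} (hf : f ∈ homog σ R j) (k : ℕ) :
    f ^ k ∈ homog σ R (k * j) := by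
  induction k with
  | zero => simpa using homog_one
  | succ k ih => rw [pow_succ, add_mul, one_mul]; exact homog_mul ih hf

theorem homog_prod {ι : Type*} (s : Finset ι) {d : ι → ℕ} {f : ι → MvPowerSeries σ R}
    (hf : ∀ i ∈ s, f i ∈ homog σ R (d i)) : ∏ i ∈ s, f i ∈ homog σ R (∑ i ∈ s, d i) := by
  classical
  induction s using Finset.induction_on with
  | empty => simpa using homog_one
  | insert a s ha ih =>
    rw [Finset.prod_insert ha, Finset.sum_insert ha]
    exact homog_mul (hf a (by simp)) (ih fun i hi => hf i (by simp [hi]))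

theorem homog_pderiv {k : ℕ} {f : MvPowerSeries σ R} (hf : f ∈ homog σ R (k + 1)) (c : σ) :
    pderiv R c f ∈ homog σ R k := by
  intro m hm
  rw [coeff_pderiv, hf _ (by simpa using hm), zero_mul]

theorem homog_zero_pderiv {f : MvPowerSeries σ R} (hf : f ∈ homog σ R 0) (c : σ) :
    pderiv R c f = 0 := by
  ext m
  rw [coeff_pderiv, hf _ (by simp), zero_mul, map_zero]

theorem homog_le_ordIdeal {k : ℕ} {f : MvPowerSeries σ R} (hf : f ∈ homog σ R k) :
    f ∈ ordIdeal σ R k :=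
  mem_ordIdeal.2 fun m hm => hf m hm.ne

theorem homog_le_span [Fintype σ] (k : ℕ) :
    homog σ R k ≤ Submodule.span R {f | ∃ m : σ →₀ ℕ, m.degree = k ∧ f = monomial m 1} := by
  classical
  intro f hf
  have : f = ∑ m ∈ Finset.univ.finsuppAntidiag k, coeff m f • monomial m (1 : R) := by
    ext m
    simp only [map_sum, map_smul, coeff_monomial, smul_eq_mul, mul_ite, mul_one, mul_zero,
      Finset.sum_ite_eq, Finset.mem_finsuppAntidiag]
    split_ifs with h
    · rfl
    · refine hf m fun hm => h ⟨?_, Finset.subset_univ _⟩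
      rw [← hm, Finsupp.degree_eq_sum]
  rw [this]
  refine Submodule.sum_mem _ fun m hm => Submodule.smul_mem _ _ (Submodule.subset_span ⟨m, ?_, rfl⟩)
  rw [Finset.mem_finsuppAntidiag] at hm
  rw [← hm.1, Finsupp.degree_eq_sum]

/-- The homogeneous part of degree `k` of a power series. -/
def homogPart (k : ℕ) (f : MvPowerSeries σ R) : MvPowerSeries σ R :=
  fun m => if m.degree = k then coeff m f else 0

theorem coeff_homogPart (k : ℕ) (f : MvPowerSeries σ R) (m : σ →₀ ℕ) :
    coeff m (homogPart k f) = if m.degree = k then coeff m f else 0 := rfl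

theorem homogPart_mem (k : ℕ) (f : MvPowerSeries σ R) : homogPart k f ∈ homog σ R k := by
  intro m hm
  rw [coeff_homogPart, if_neg hm]

theorem sub_homogPart_mem {k : ℕ} {f : MvPowerSeries σ R} (hf : f ∈ ordIdeal σ R k) :
    f - homogPart k f ∈ ordIdeal σ R (k + 1) := by
  rw [mem_ordIdeal] at *
  intro m hm
  rw [map_sub, coeff_homogPart]
  split_ifs with h
  · simp
  · rw [hf m (by omega), sub_zero]

theorem rescale_homogPart (ε : σ → R) (k : ℕ) (f : MvPowerSeries σ R) :
    rescale ε (homogPart k f) = homogPart k (rescale ε f) := by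
  ext m
  rw [coeff_rescale, coeff_homogPart, coeff_homogPart, coeff_rescale]
  split_ifs <;> simp

theorem homogPart_C_mul (a : R) (k : ℕ) (f : MvPowerSeries σ R) :
    homogPart k (C a * f) = C a * homogPart k f := by
  ext m
  rw [coeff_homogPart, coeff_C_mul, coeff_C_mul, coeff_homogPart]
  split_ifs <;> simp

theorem rescale_mem_homog (ε : σ → R) {k : ℕ} {f : MvPowerSeries σ R} (hf : f ∈ homog σ R k) :
    rescale ε f ∈ homog σ R k := by
  intro m hm
  rw [coeff_rescale, hf m hm, mul_zero]

/-- The derivation of the power series ring given by a formal vector field. -/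
def der [Fintype σ] (V : σ → MvPowerSeries σ R) :
    Derivation R (MvPowerSeries σ R) (MvPowerSeries σ R) := ∑ d, V d • pderiv R d

theorem der_apply [Fintype σ] (V : σ → MvPowerSeries σ R) (f : MvPowerSeries σ R) :
    der V f = ∑ d, pderiv R d f * V d := by
  have : ∀ s : Finset σ, (∑ d ∈ s, V d • pderiv R d) f = ∑ d ∈ s, pderiv R d f * V d := by
    classical
    intro s
    induction s using Finset.induction_on with
    | empty => simp
    | insert a s ha ih =>
      rw [Finset.sum_insert ha, Finset.sum_insert ha, Derivation.add_apply, ih,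
        Derivation.smul_apply, smul_eq_mul, mul_comm]
  exact this _

theorem der_X [Fintype σ] (V : σ → MvPowerSeries σ R) (c : σ) : der V (X c) = V c := by
  classical
  rw [der_apply, Finset.sum_eq_single c]
  · rw [pderiv_X_self, one_mul]
  · intro d _ hd
    rw [pderiv_X_of_ne hd.symm, zero_mul]
  · simp

theorem homog_der [Fintype σ] {V : σ → MvPowerSeries σ R} (hV : ∀ c, V c ∈ homog σ R 1) {k : ℕ}
    {f : MvPowerSeries σ R} (hf : f ∈ homog σ R k) : der V f ∈ homog σ R k := by
  rw [der_apply]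
  refine Submodule.sum_mem _ fun d _ => ?_
  cases k with
  | zero => rw [homog_zero_pderiv hf, zero_mul]; exact Submodule.zero_mem _
  | succ k => exact homog_mul (homog_pderiv hf d) (hV d)

end Homogeneous

section LinearPart

variable {R : Type*} [CommRing R] {n : ℕ}

/-- The linear vector field applied to a formal map. -/
def linAct (ω : Fin n → R) (F : Coord n → MvPowerSeries (Coord n) R) :
    Coord n → MvPowerSeries (Coord n) R
  | .inl i => if i = 0 then F (.inl 1) else 0
  | .inr (.inl j) => C (ω j) * F (.inr (.inr j))
  | .inr (.inr j) => -(C (ω j) * F (.inr (.inl j)))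

/-- The linear vector field as a formal field. -/
def lin (ω : Fin n → R) : Coord n → MvPowerSeries (Coord n) R := linAct ω X

theorem lin_mem_homog (ω : Fin n → R) (c : Coord n) : lin ω c ∈ homog (Coord n) R 1 := by
  rcases c with i | j | j
  · simp only [lin, linAct]
    split_ifs
    · exact homog_X _
    · exact Submodule.zero_mem _
  · exact homog_C_mul _ (homog_X _)
  · exact Submodule.neg_mem _ (homog_C_mul _ (homog_X _))

theorem subst_lin (ω : Fin n → R) {Φ : Coord n → MvPowerSeries (Coord n) R} (h : HasSubst Φ)
    (c : Coord n) : subst Φ (lin ω c) = linAct ω Φ c := by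
  rcases c with i | j | j
  · simp only [lin, linAct]
    split_ifs
    · rw [subst_X h]
    · rw [← coe_substAlgHom h, map_zero]
  · simp only [lin, linAct]
    rw [subst_mul h, subst_C, subst_X h]
  · simp only [lin, linAct]
    rw [← coe_substAlgHom h, map_neg, coe_substAlgHom h, subst_mul h, subst_C, subst_X h]

theorem linAct_add (ω : Fin n → R) (F G : Coord n → MvPowerSeries (Coord n) R) :
    linAct ω (F + G) = linAct ω F + linAct ω G := by
  funext c
  rcases c with i | j | j
  · by_cases h : i = 0 <;> simp [linAct, h]
  · simp [linAct, mul_add]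
  · simp [linAct, mul_add]; ring

theorem linAct_smul (ω : Fin n → R) (a : R) (F : Coord n → MvPowerSeries (Coord n) R) :
    linAct ω (a • F) = a • linAct ω F := by
  funext c
  rcases c with i | j | j
  · by_cases h : i = 0 <;> simp [linAct, h]
  · simp [linAct]
  · simp [linAct]

/-- The homological operator: the Lie bracket with the linear part. -/
def adL (ω : Fin n → R) : (Coord n → MvPowerSeries (Coord n) R) →ₗ[R]
    (Coord n → MvPowerSeries (Coord n) R) where
  toFun F c := der (lin ω) (F c) - linAct ω F c
  map_add' F G := by
    funext c
    simp only [linAct_add, Pi.add_apply, map_add]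
    ring
  map_smul' a F := by
    funext c
    simp only [linAct_smul, Pi.smul_apply, RingHom.id_apply, Derivation.map_smul, smul_sub]

theorem adL_apply (ω : Fin n → R) (F : Coord n → MvPowerSeries (Coord n) R) (c : Coord n) :
    adL ω F c = der (lin ω) (F c) - linAct ω F c := rfl

end LinearPart

section ComplexMonomials

variable {n : ℕ}

/-- The ring of complex power series in the real coordinates. -/
abbrev CSer (n : ℕ) : Type := MvPowerSeries (Coord n) ℂ

/-- The coordinate `z_j = u_j + i v_j`. -/
def zc (j : Fin n) : CSer n := X (.inr (.inl j)) + C Complex.I * X (.inr (.inr j))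

/-- The conjugate coordinate `z̄_j = u_j - i v_j`. -/
def wc (j : Fin n) : CSer n := X (.inr (.inl j)) - C Complex.I * X (.inr (.inr j))

/-- The monomial `z^p z̄^q`. -/
def zMono (p q : Fin n → ℕ) : CSer n := ∏ j, (zc j ^ p j * wc j ^ q j)

/-- The derivation given by the linear vector field, on complex series. -/
abbrev cder (ω : Fin n → ℝ) : Derivation ℂ (CSer n) (CSer n) := der (lin fun j => (ω j : ℂ))

theorem C_I_mul : (C Complex.I * C Complex.I : CSer n) = -1 := by
  rw [← map_mul, Complex.I_mul_I, map_neg, map_one]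

theorem cder_C_mul (ω : Fin n → ℝ) (a : ℂ) (f : CSer n) :
    cder ω (C a * f) = C a * cder ω f := by
  rw [← smul_eq_C_mul, Derivation.map_smul, smul_eq_C_mul]

theorem cder_zc (ω : Fin n → ℝ) (j : Fin n) :
    cder ω (zc j) = C (-Complex.I * ω j) * zc j := by
  rw [zc, map_add, cder_C_mul, der_X, der_X]
  simp only [lin, linAct, map_mul, map_neg]
  linear_combination (C (ω j : ℂ) * X (Sum.inr (Sum.inr j))) * C_I_mul (n := n)

theorem cder_wc (ω : Fin n → ℝ) (j : Fin n) :
    cder ω (wc j) = C (Complex.I * ω j) * wc j := by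
  rw [wc, map_sub, cder_C_mul, der_X, der_X]
  simp only [lin, linAct, map_mul]
  linear_combination (C (ω j : ℂ) * X (Sum.inr (Sum.inr j))) * C_I_mul (n := n)

theorem eigen_mul {D : Derivation ℂ (CSer n) (CSer n)} {f g : CSer n} {a b : ℂ}
    (hf : D f = C a * f) (hg : D g = C b * g) : D (f * g) = C (a + b) * (f * g) := by
  rw [Derivation.leibniz, hf, hg, map_add, smul_eq_mul, smul_eq_mul]; ring

theorem eigen_pow {D : Derivation ℂ (CSer n) (CSer n)} {f : CSer n} {a : ℂ}
    (hf : D f = C a * f) (k : ℕ) : D (f ^ k) = C (k * a) * f ^ k := by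
  induction k with
  | zero => simp
  | succ k ih => rw [pow_succ, eigen_mul ih hf]; congr 2; push_cast; ring

theorem eigen_prod {ι : Type*} (s : Finset ι) {D : Derivation ℂ (CSer n) (CSer n)}
    {f : ι → CSer n} {a : ι → ℂ} (hf : ∀ i, D (f i) = C (a i) * f i) :
    D (∏ i ∈ s, f i) = C (∑ i ∈ s, a i) * ∏ i ∈ s, f i := by
  classical
  induction s using Finset.induction_on with
  | empty => simp
  | insert i s hi ih =>
    rw [Finset.prod_insert hi, Finset.sum_insert hi]
    exact eigen_mul (hf i) ih

/-- The frequency `⟨ω, p - q⟩` of the monomial `z^p z̄^q`. -/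
def freq (ω : Fin n → ℝ) (p q : Fin n → ℕ) : ℝ := ∑ j, ω j * ((p j : ℝ) - q j)

theorem cder_zMono (ω : Fin n → ℝ) (p q : Fin n → ℕ) :
    cder ω (zMono p q) = C (-Complex.I * freq ω p q) * zMono p q := by
  rw [zMono, eigen_prod (D := cder ω) (f := fun j => zc j ^ p j * wc j ^ q j)
    (a := fun j => -Complex.I * (ω j * ((p j : ℂ) - q j)))]
  · congr 2
    rw [freq, ← Finset.mul_sum]
    push_cast
    rfl
  · intro j
    rw [eigen_mul (eigen_pow (cder_zc ω j) _) (eigen_pow (cder_wc ω j) _)]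
    congr 2
    ring

/-- The monomial `x₁^a x₂^b f`. -/
def xMono (a b : ℕ) (f : CSer n) : CSer n := X (.inl 0) ^ a * X (.inl 1) ^ b * f

theorem cder_xMono (ω : Fin n → ℝ) (a b : ℕ) {f : CSer n} {ν : ℂ}
    (hf : cder ω f = C ν * f) :
    cder ω (xMono a b f) = C (a : ℂ) * xMono (a - 1) (b + 1) f + C ν * xMono a b f := by
  have h1 : cder ω (X (.inl 0)) = X (.inl 1) := by rw [der_X]; rfl
  have h2 : cder ω (X (.inl 1)) = 0 := by rw [der_X]; rfl
  simp only [xMono, Derivation.leibniz, Derivation.leibniz_pow, h1, h2, hf, smul_eq_mul,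
    nsmul_eq_mul, map_natCast]
  ring

theorem homog_zc (j : Fin n) : zc j ∈ homog (Coord n) ℂ 1 :=
  Submodule.add_mem _ (homog_X _) (homog_C_mul Complex.I (homog_X _))

theorem homog_wc (j : Fin n) : wc j ∈ homog (Coord n) ℂ 1 :=
  Submodule.sub_mem _ (homog_X _) (homog_C_mul Complex.I (homog_X _))

theorem homog_zMono (p q : Fin n → ℕ) :
    zMono p q ∈ homog (Coord n) ℂ (∑ j, (p j + q j)) := by
  refine homog_prod _ fun j _ => homog_mul ?_ ?_
  · simpa using homog_pow (homog_zc j) (p j)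
  · simpa using homog_pow (homog_wc j) (q j)

theorem homog_xMono (a b : ℕ) {f : CSer n} {k : ℕ} (hf : f ∈ homog (Coord n) ℂ k) :
    xMono a b f ∈ homog (Coord n) ℂ (a + b + k) := by
  have := homog_mul (homog_mul (homog_pow (homog_X (R := ℂ) (Sum.inl 0 : Coord n)) a)
    (homog_pow (homog_X (R := ℂ) (Sum.inl 1 : Coord n)) b)) hf
  simpa [xMono] using this

/-- The complex monomials of degree `k`. -/
def cMonos (n k : ℕ) : Set (CSer n) :=
  {f | ∃ a b p q, a + b + ∑ j, (p j + q j) = k ∧ f = xMono a b (zMono p q)}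

theorem zc_mul_zMono (j : Fin n) (p q : Fin n → ℕ) :
    zc j * zMono p q = zMono (p + Pi.single j 1) q := by
  simp only [zMono, Pi.add_apply, pow_add, Finset.prod_mul_distrib]
  rw [Finset.prod_eq_single (f := fun k => zc k ^ (Pi.single j 1 : Fin n → ℕ) k) j]
  · simp; ring
  · intro k _ hk; simp [hk]
  · simp

theorem wc_mul_zMono (j : Fin n) (p q : Fin n → ℕ) :
    wc j * zMono p q = zMono p (q + Pi.single j 1) := by
  simp only [zMono, Pi.add_apply, pow_add, Finset.prod_mul_distrib]
  rw [Finset.prod_eq_single (f := fun k => wc k ^ (Pi.single j 1 : Fin n → ℕ) k) j]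
  · simp; ring
  · intro k _ hk; simp [hk]
  · simp

theorem X_mul_mem_span_cMonos (c : Coord n) {k : ℕ} {f : CSer n}
    (hf : f ∈ Submodule.span ℂ (cMonos n k)) :
    X c * f ∈ Submodule.span ℂ (cMonos n (k + 1)) := by
  suffices h : Submodule.span ℂ (cMonos n k) ≤
      (Submodule.span ℂ (cMonos n (k + 1))).comap (LinearMap.mulLeft ℂ (X c)) from h hf
  rw [Submodule.span_le]
  rintro _ ⟨a, b, p, q, hk, rfl⟩
  change X c * xMono a b (zMono p q) ∈ Submodule.span ℂ (cMonos n (k + 1))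
  have hz : ∀ j, zc j * xMono a b (zMono p q) ∈ Submodule.span ℂ (cMonos n (k + 1)) := fun j =>
    Submodule.subset_span ⟨a, b, p + Pi.single j 1, q, by
      simp only [Pi.add_apply, Finset.sum_add_distrib, Finset.sum_pi_single', Finset.mem_univ,
        if_true] at *; omega, by rw [← zc_mul_zMono, xMono, xMono]; ring⟩
  have hw : ∀ j, wc j * xMono a b (zMono p q) ∈ Submodule.span ℂ (cMonos n (k + 1)) := fun j =>
    Submodule.subset_span ⟨a, b, p, q + Pi.single j 1, by
      simp only [Pi.add_apply, Finset.sum_add_distrib, Finset.sum_pi_single', Finset.mem_univ,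
        if_true] at *; omega, by rw [← wc_mul_zMono, xMono, xMono]; ring⟩
  have h2 : (C (2⁻¹ : ℂ) * 2 : CSer n) = 1 := by
    rw [← map_ofNat (C (σ := Coord n) (R := ℂ)) 2, ← map_mul]; simp
  rcases c with i | j | j
  · fin_cases i
    · exact Submodule.subset_span ⟨a + 1, b, p, q, by omega, by
        change X (Sum.inl 0) * _ = _
        simp only [xMono]; ring⟩
    · exact Submodule.subset_span ⟨a, b + 1, p, q, by omega, by
        change X (Sum.inl 1) * _ = _
        simp only [xMono]; ring⟩
  · have : (X (Sum.inr (Sum.inl j)) : CSer n) * xMono a b (zMono p q) =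
        (2⁻¹ : ℂ) • (zc j * xMono a b (zMono p q) + wc j * xMono a b (zMono p q)) := by
      rw [smul_eq_C_mul, zc, wc]
      linear_combination (-X (Sum.inr (Sum.inl j)) * xMono a b (zMono p q)) * h2
    rw [this]
    exact Submodule.smul_mem _ _ (Submodule.add_mem _ (hz j) (hw j))
  · have : (X (Sum.inr (Sum.inr j)) : CSer n) * xMono a b (zMono p q) =
        (-Complex.I * 2⁻¹ : ℂ) • (zc j * xMono a b (zMono p q) - wc j * xMono a b (zMono p q)) := by
      rw [smul_eq_C_mul, zc, wc, map_mul, map_neg]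
      linear_combination (-X (Sum.inr (Sum.inr j)) * xMono a b (zMono p q)) * h2
        + (X (Sum.inr (Sum.inr j)) * xMono a b (zMono p q) * C (2⁻¹ : ℂ) * 2) * C_I_mul (n := n)
    rw [this]
    exact Submodule.smul_mem _ _ (Submodule.sub_mem _ (hz j) (hw j))

theorem homog_le_span_cMonos (k : ℕ) :
    homog (Coord n) ℂ k ≤ Submodule.span ℂ (cMonos n k) := by
  refine (homog_le_span k).trans (Submodule.span_le.2 ?_)
  rintro _ ⟨m, rfl, rfl⟩
  have h0 : (1 : CSer n) ∈ Submodule.span ℂ (cMonos n 0) :=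
    Submodule.subset_span ⟨0, 0, 0, 0, by simp, by simp [xMono, zMono]⟩
  have step : ∀ (c : Coord n) (k : ℕ) (m : Coord n →₀ ℕ),
      (monomial m 1 : CSer n) ∈ Submodule.span ℂ (cMonos n m.degree) →
      (monomial (m + Finsupp.single c k) 1 : CSer n) ∈
        Submodule.span ℂ (cMonos n (m + Finsupp.single c k).degree) := by
    intro c k
    induction k with
    | zero => intro m h; simpa using h
    | succ k ih =>
      intro m h
      have := X_mul_mem_span_cMonos c (ih m h)
      rw [X, monomial_mul_monomial, one_mul] at this
      rw [Finsupp.single_add, ← add_assoc, map_add, Finsupp.degree_single, add_comm _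
        (Finsupp.single c 1)]
      exact this
  induction m using Finsupp.induction with
  | zero => simpa using h0
  | single_add c k f _ _ ih => rw [add_comm (Finsupp.single c k)]; exact step c k f ih

end ComplexMonomials

section Solvability

variable {n : ℕ}

/-- The span of the monomials `x₁^a x₂^b f` with `a + b = k`. -/
def xSpan (f : CSer n) (k : ℕ) : Submodule ℂ (CSer n) :=
  Submodule.span ℂ {g | ∃ a b, a + b = k ∧ g = xMono a b f}

theorem xSpan_le_homog {f : CSer n} {j k l : ℕ} (hf : f ∈ homog (Coord n) ℂ j) (h : k + j = l) :
    xSpan f k ≤ homog (Coord n) ℂ l := by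
  refine Submodule.span_le.2 ?_
  rintro _ ⟨a, b, rfl, rfl⟩
  rw [← h]
  exact homog_xMono a b hf

/-- The operator `D + μ`. -/
def shiftOp (ω : Fin n → ℝ) (μ : ℂ) : CSer n →ₗ[ℂ] CSer n :=
  (cder ω).toLinearMap + μ • LinearMap.id

theorem shiftOp_apply (ω : Fin n → ℝ) (μ : ℂ) (f : CSer n) :
    shiftOp ω μ f = cder ω f + C μ * f := by
  rw [← smul_eq_C_mul]; rfl

theorem shiftOp_xMono (ω : Fin n → ℝ) (μ : ℂ) (a b : ℕ) {f : CSer n} {ν : ℂ}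
    (hf : cder ω f = C ν * f) :
    shiftOp ω μ (xMono a b f) =
      (a : ℂ) • xMono (a - 1) (b + 1) f + (ν + μ) • xMono a b f := by
  rw [shiftOp_apply, cder_xMono ω a b hf, smul_eq_C_mul, smul_eq_C_mul, map_add C ν]
  ring

theorem xSpan_le_map_shiftOp (ω : Fin n → ℝ) (μ : ℂ) {f : CSer n} {ν : ℂ}
    (hf : cder ω f = C ν * f) (h : ν + μ ≠ 0) (k : ℕ) :
    xSpan f k ≤ (xSpan f k).map (shiftOp ω μ) := by
  refine Submodule.span_le.2 ?_
  have key : ∀ a b, a + b = k → xMono a b f ∈ (xSpan f k).map (shiftOp ω μ) := by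
    intro a
    induction a with
    | zero =>
      intro b hb
      refine ⟨(ν + μ)⁻¹ • xMono 0 b f, Submodule.smul_mem _ _
        (Submodule.subset_span ⟨0, b, hb, rfl⟩), ?_⟩
      rw [map_smul, shiftOp_xMono ω μ 0 b hf, Nat.cast_zero, zero_smul, zero_add, smul_smul,
        inv_mul_cancel₀ h, one_smul]
    | succ a ih =>
      intro b hb
      have e : xMono (a + 1) b f = (ν + μ)⁻¹ • (shiftOp ω μ (xMono (a + 1) b f)
          - ((a + 1 : ℕ) : ℂ) • xMono a (b + 1) f) := by
        rw [shiftOp_xMono ω μ (a + 1) b hf, Nat.add_sub_cancel, add_sub_cancel_left, smul_smul,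
          inv_mul_cancel₀ h, one_smul]
      rw [e]
      refine Submodule.smul_mem _ _ (Submodule.sub_mem _ ?_ (Submodule.smul_mem _ _
        (ih (b + 1) (by omega))))
      exact Submodule.mem_map_of_mem (Submodule.subset_span ⟨a + 1, b, hb, rfl⟩)
  rintro _ ⟨a, b, hab, rfl⟩
  exact key a b hab

theorem xMono_mem_map_shiftOp (ω : Fin n → ℝ) (μ : ℂ) {f : CSer n} {ν : ℂ}
    (hf : cder ω f = C ν * f) (h : ν + μ = 0) {a b k : ℕ} (hk : a + (b + 1) = k) :
    xMono a (b + 1) f ∈ (xSpan f k).map (shiftOp ω μ) := by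
  refine ⟨((a + 1 : ℕ) : ℂ)⁻¹ • xMono (a + 1) b f, Submodule.smul_mem _ _
    (Submodule.subset_span ⟨a + 1, b, by omega, rfl⟩), ?_⟩
  rw [map_smul, shiftOp_xMono ω μ (a + 1) b hf, h, zero_smul, add_zero, smul_smul,
    inv_mul_cancel₀ (by exact_mod_cast Nat.succ_ne_zero a), one_smul, Nat.add_sub_cancel]

theorem xMono_mem_map_shiftOp_sq (ω : Fin n → ℝ) {f : CSer n}
    (hf : cder ω f = C 0 * f) {a b k : ℕ} (hk : a + (b + 2) = k) :
    xMono a (b + 2) f ∈ (xSpan f k).map (shiftOp ω 0 ∘ₗ shiftOp ω 0) := by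
  refine ⟨((a + 1 : ℕ) : ℂ)⁻¹ • ((a + 2 : ℕ) : ℂ)⁻¹ • xMono (a + 2) b f, Submodule.smul_mem _ _
    (Submodule.smul_mem _ _ (Submodule.subset_span ⟨a + 2, b, by omega, rfl⟩)), ?_⟩
  rw [LinearMap.comp_apply, map_smul, map_smul, map_smul, shiftOp_xMono ω 0 (a + 2) b hf, add_zero,
    zero_smul, add_zero, smul_smul ((a + 2 : ℕ) : ℂ)⁻¹,
    inv_mul_cancel₀ (by exact_mod_cast Nat.succ_ne_zero (a + 1)), one_smul,
    shiftOp_xMono ω 0 _ _ hf, add_zero, zero_smul, add_zero, smul_smul]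
  rw [show a + 2 - 1 = a + 1 by omega, inv_mul_cancel₀ (by exact_mod_cast Nat.succ_ne_zero a),
    one_smul, Nat.add_sub_cancel]

theorem freq_eq_zero {ω : Fin n → ℝ} (hω : LinearIndependent ℚ ω) {p q : Fin n → ℕ}
    (h : freq ω p q = 0) : p = q := by
  rw [Fintype.linearIndependent_iff] at hω
  have := hω (fun j => (p j : ℚ) - q j) (by
    rw [← h, freq]
    refine Finset.sum_congr rfl fun j _ => ?_
    rw [Rat.smul_def]; push_cast; ring)
  funext j
  have hj := this j
  rw [sub_eq_zero] at hj
  exact_mod_cast hj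

theorem freq_eq_self {ω : Fin n → ℝ} (hω : LinearIndependent ℚ ω) {p q : Fin n → ℕ} {j : Fin n}
    (h : freq ω p q = ω j) : p = q + Pi.single j 1 := by
  refine freq_eq_zero hω ?_
  have : freq ω p (q + Pi.single j 1) = freq ω p q - ω j := by
    simp only [freq, Pi.add_apply, Nat.cast_add]
    have e : ∀ k, ω k * ((p k : ℝ) - ((q k : ℝ) + ((Pi.single j 1 : Fin n → ℕ) k : ℝ))) =
        ω k * ((p k : ℝ) - q k) - if k = j then ω k else 0 := by
      intro k
      by_cases hk : k = j
      · subst hk; simp; ring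
      · simp [hk]
    simp_rw [e, Finset.sum_sub_distrib]
    simp
  rw [this, h, sub_self]

/-- Resonant terms in the direction of `z_j`. -/
def zRes (n k : ℕ) (j : Fin n) : Set (CSer n) :=
  {f | ∃ (a : ℕ) (q : Fin n → ℕ), a + 2 * ∑ i, q i + 1 = k ∧ f = xMono a 0 (zc j * zMono q q)}

/-- Resonant terms in the directions of `x₁`, `x₂`. -/
def xRes (n k : ℕ) : Set (CSer n) :=
  {f | ∃ (a b : ℕ) (q : Fin n → ℕ), b ≤ 1 ∧ a + b + 2 * ∑ i, q i = k ∧ f = xMono a b (zMono q q)}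

theorem homog_le_z {ω : Fin n → ℝ} (hω : LinearIndependent ℚ ω) (k : ℕ) (j : Fin n) :
    homog (Coord n) ℂ k ≤ (homog (Coord n) ℂ k).map (shiftOp ω (Complex.I * ω j)) ⊔
      Submodule.span ℂ (zRes n k j) := by
  refine (homog_le_span_cMonos k).trans (Submodule.span_le.2 ?_)
  rintro _ ⟨a, b, p, q, hk, rfl⟩
  have hle : xSpan (zMono p q) (a + b) ≤ homog (Coord n) ℂ k :=
    xSpan_le_homog (homog_zMono p q) hk
  by_cases h : freq ω p q = ω j
  · have h0 : -Complex.I * freq ω p q + Complex.I * ω j = 0 := by rw [h]; ring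
    cases b with
    | succ b =>
      exact Submodule.mem_sup_left (Submodule.map_mono hle
        (xMono_mem_map_shiftOp ω _ (cder_zMono ω p q) h0 rfl))
    | zero =>
      refine Submodule.mem_sup_right (Submodule.subset_span ⟨a, q, ?_, ?_⟩)
      · rw [freq_eq_self hω h] at hk
        simp only [Pi.add_apply, Finset.sum_add_distrib, Finset.sum_pi_single', Finset.mem_univ,
          if_true] at hk
        omega
      · rw [zc_mul_zMono, freq_eq_self hω h]
  · have h0 : -Complex.I * freq ω p q + Complex.I * ω j ≠ 0 := by
      intro h0
      apply h
      have : Complex.I * ((ω j : ℂ) - freq ω p q) = 0 := by rw [← h0]; ring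
      rcases mul_eq_zero.1 this with h1 | h1
      · exact absurd h1 Complex.I_ne_zero
      · exact_mod_cast (sub_eq_zero.1 h1).symm
    exact Submodule.mem_sup_left (Submodule.map_mono hle
      (xSpan_le_map_shiftOp ω _ (cder_zMono ω p q) h0 _ (Submodule.subset_span ⟨a, b, rfl, rfl⟩)))

theorem homog_le_x {ω : Fin n → ℝ} (hω : LinearIndependent ℚ ω) (k : ℕ) :
    homog (Coord n) ℂ k ≤ (homog (Coord n) ℂ k).map (shiftOp ω 0 ∘ₗ shiftOp ω 0) ⊔
      Submodule.span ℂ (xRes n k) := by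
  refine (homog_le_span_cMonos k).trans (Submodule.span_le.2 ?_)
  rintro _ ⟨a, b, p, q, hk, rfl⟩
  have hle : xSpan (zMono p q) (a + b) ≤ homog (Coord n) ℂ k :=
    xSpan_le_homog (homog_zMono p q) hk
  by_cases h : freq ω p q = 0
  · have hf : cder ω (zMono p q) = C 0 * zMono p q := by
      rw [cder_zMono, h, Complex.ofReal_zero, mul_zero]
    by_cases hb : b ≤ 1
    · refine Submodule.mem_sup_right (Submodule.subset_span ⟨a, b, q, hb, ?_, ?_⟩)
      · rw [freq_eq_zero hω h, Finset.sum_add_distrib] at hk; omega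
      · rw [freq_eq_zero hω h]
    · obtain ⟨b, rfl⟩ : ∃ b', b = b' + 2 := ⟨b - 2, by omega⟩
      exact Submodule.mem_sup_left (Submodule.map_mono hle
        (xMono_mem_map_shiftOp_sq ω hf rfl))
  · have h0 : -Complex.I * freq ω p q + 0 ≠ 0 := by
      simpa using h
    refine Submodule.mem_sup_left (Submodule.map_mono hle ?_)
    have h1 := xSpan_le_map_shiftOp ω 0 (cder_zMono ω p q) h0 (a + b)
    rw [Submodule.map_comp]
    exact (h1.trans (Submodule.map_mono h1)) (Submodule.subset_span ⟨a, b, rfl, rfl⟩)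

end Solvability

section RealPart

variable {σ : Type*}

/-- The coefficientwise real part. -/
def reS : MvPowerSeries σ ℂ →ₗ[ℝ] MvPowerSeries σ ℝ where
  toFun f m := (coeff m f).re
  map_add' _ _ := rfl
  map_smul' a f := by
    funext m
    change (a • (f m)).re = a * (f m).re
    simp

/-- The coefficientwise imaginary part. -/
def imS : MvPowerSeries σ ℂ →ₗ[ℝ] MvPowerSeries σ ℝ where
  toFun f m := (coeff m f).im
  map_add' _ _ := rfl
  map_smul' a f := by
    funext m
    change (a • (f m)).im = a * (f m).im
    simp

theorem coeff_reS (f : MvPowerSeries σ ℂ) (m : σ →₀ ℕ) : coeff m (reS f) = (coeff m f).re := rfl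

theorem coeff_imS (f : MvPowerSeries σ ℂ) (m : σ →₀ ℕ) : coeff m (imS f) = (coeff m f).im := rfl

/-- A real series as a complex one. -/
abbrev toC (f : MvPowerSeries σ ℝ) : MvPowerSeries σ ℂ := map Complex.ofRealHom f

theorem reS_toC_mul (r : MvPowerSeries σ ℝ) (f : MvPowerSeries σ ℂ) :
    reS (toC r * f) = r * reS f := by
  classical
  ext m
  rw [coeff_reS, coeff_mul, coeff_mul, Complex.re_sum]
  refine Finset.sum_congr rfl fun p _ => ?_
  rw [coeff_reS, coeff_map, Complex.ofRealHom_eq_coe, Complex.re_ofReal_mul]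

theorem imS_toC_mul (r : MvPowerSeries σ ℝ) (f : MvPowerSeries σ ℂ) :
    imS (toC r * f) = r * imS f := by
  classical
  ext m
  rw [coeff_imS, coeff_mul, coeff_mul, Complex.im_sum]
  refine Finset.sum_congr rfl fun p _ => ?_
  rw [coeff_imS, coeff_map, Complex.ofRealHom_eq_coe, Complex.im_ofReal_mul]

theorem reS_C_mul (c : ℂ) (f : MvPowerSeries σ ℂ) :
    reS (C c * f) = C c.re * reS f - C c.im * imS f := by
  ext m
  simp [coeff_reS, coeff_imS, coeff_C_mul]

theorem imS_C_mul (c : ℂ) (f : MvPowerSeries σ ℂ) :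
    imS (C c * f) = C c.re * imS f + C c.im * reS f := by
  ext m
  simp [coeff_reS, coeff_imS, coeff_C_mul]

theorem reS_pderiv (c : σ) (f : MvPowerSeries σ ℂ) :
    reS (pderiv ℂ c f) = pderiv ℝ c (reS f) := by
  ext m
  rw [coeff_reS, coeff_pderiv, coeff_pderiv, coeff_reS]
  simp

theorem imS_pderiv (c : σ) (f : MvPowerSeries σ ℂ) :
    imS (pderiv ℂ c f) = pderiv ℝ c (imS f) := by
  ext m
  rw [coeff_imS, coeff_pderiv, coeff_pderiv, coeff_imS]
  simp

theorem reS_toC (f : MvPowerSeries σ ℝ) : reS (toC f) = f := by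
  ext m; rw [coeff_reS, coeff_map]; simp

theorem imS_toC (f : MvPowerSeries σ ℝ) : imS (toC f) = 0 := by
  ext m; rw [coeff_imS, coeff_map]; simp

theorem reS_mem_homog {k : ℕ} {f : MvPowerSeries σ ℂ} (hf : f ∈ homog σ ℂ k) :
    reS f ∈ homog σ ℝ k := fun m hm => by rw [coeff_reS, hf m hm, Complex.zero_re]

theorem imS_mem_homog {k : ℕ} {f : MvPowerSeries σ ℂ} (hf : f ∈ homog σ ℂ k) :
    imS f ∈ homog σ ℝ k := fun m hm => by rw [coeff_imS, hf m hm, Complex.zero_im]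

theorem toC_mem_homog {k : ℕ} {f : MvPowerSeries σ ℝ} (hf : f ∈ homog σ ℝ k) :
    toC f ∈ homog σ ℂ k := fun m hm => by rw [coeff_map, hf m hm, map_zero]

theorem toC_lin {n : ℕ} (ω : Fin n → ℝ) (c : Coord n) :
    toC (lin ω c) = lin (fun j => (ω j : ℂ)) c := by
  rcases c with i | j | j
  · simp only [lin, linAct]
    split_ifs <;> simp
  · simp [lin, linAct]
  · simp [lin, linAct]

theorem reS_cder {n : ℕ} (ω : Fin n → ℝ) (f : CSer n) :
    reS (cder ω f) = der (lin ω) (reS f) := by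
  rw [der_apply, der_apply, map_sum]
  refine Finset.sum_congr rfl fun c _ => ?_
  rw [← toC_lin, mul_comm, reS_toC_mul, reS_pderiv, mul_comm]

theorem imS_cder {n : ℕ} (ω : Fin n → ℝ) (f : CSer n) :
    imS (cder ω f) = der (lin ω) (imS f) := by
  rw [der_apply, der_apply, map_sum]
  refine Finset.sum_congr rfl fun c _ => ?_
  rw [← toC_lin, mul_comm, imS_toC_mul, imS_pderiv, mul_comm]

end RealPart

section RealHomological

variable {n : ℕ}

/-- The ring of real power series in the real coordinates. -/
abbrev RSer (n : ℕ) : Type := MvPowerSeries (Coord n) ℝ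

/-- The series `u_j² + v_j²`. -/
def radius (j : Fin n) : RSer n := X (.inr (.inl j)) ^ 2 + X (.inr (.inr j)) ^ 2

/-- The monomial `x₁^a ∏ (u_j² + v_j²)^{q_j}`. -/
def rMono (a : ℕ) (q : Fin n → ℕ) : RSer n := X (.inl 0) ^ a * ∏ j, radius j ^ q j

/-- The field with components `f`, `g` in the `(x₁, x₂)`-plane. -/
def xField (f g : RSer n) : Coord n → RSer n
  | .inl i => if i = 0 then f else g
  | .inr _ => 0

/-- The field with components `f`, `g` in the `z_j`-plane. -/
def zField (j : Fin n) (f g : RSer n) : Coord n → RSer n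
  | .inl _ => 0
  | .inr (.inl k) => if k = j then f else 0
  | .inr (.inr k) => if k = j then g else 0

theorem xField_add (f g f' g' : RSer n) :
    xField f g + xField f' g' = xField (f + f') (g + g') := by
  funext c
  rcases c with i | c
  · by_cases h : i = 0 <;> simp [xField, h]
  · simp [xField]

theorem xField_smul (a : ℝ) (f g : RSer n) : a • xField f g = xField (a • f) (a • g) := by
  funext c
  rcases c with i | c
  · by_cases h : i = 0 <;> simp [xField, h]
  · simp [xField]

theorem zField_add (j : Fin n) (f g f' g' : RSer n) :
    zField j f g + zField j f' g' = zField j (f + f') (g + g') := by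
  funext c
  rcases c with i | k | k
  · simp [zField]
  · by_cases h : k = j <;> simp [zField, h]
  · by_cases h : k = j <;> simp [zField, h]

theorem zField_smul (j : Fin n) (a : ℝ) (f g : RSer n) :
    a • zField j f g = zField j (a • f) (a • g) := by
  funext c
  rcases c with i | k | k
  · simp [zField]
  · by_cases h : k = j <;> simp [zField, h]
  · by_cases h : k = j <;> simp [zField, h]

theorem field_decomp (F : Coord n → RSer n) :
    F = xField (F (.inl 0)) (F (.inl 1)) +
      ∑ j, zField j (F (.inr (.inl j))) (F (.inr (.inr j))) := by
  funext c
  rcases c with i | k | k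
  · fin_cases i <;> simp [xField, zField]
  · simp [xField, zField]
  · simp [xField, zField]

/-- The resonant fields of degree `k`. -/
def resFields (n k : ℕ) : Set (Coord n → RSer n) :=
  {F | ∃ (a b : ℕ) (q : Fin n → ℕ), b ≤ 1 ∧ a + b + 2 * ∑ i, q i = k ∧
      F = xField 0 (rMono a q * X (.inl 1) ^ b)} ∪
  {F | ∃ (j : Fin n) (a : ℕ) (q : Fin n → ℕ), a + 2 * ∑ i, q i + 1 = k ∧
      (F = zField j (rMono a q * X (.inr (.inl j))) (rMono a q * X (.inr (.inr j))) ∨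
        F = zField j (-(rMono a q * X (.inr (.inr j)))) (rMono a q * X (.inr (.inl j))))}

/-- The homogeneous formal fields of degree `k`. -/
def fieldHomog (n k : ℕ) : Submodule ℝ (Coord n → RSer n) :=
  Submodule.pi Set.univ fun _ => homog (Coord n) ℝ k

theorem mem_fieldHomog {k : ℕ} {F : Coord n → RSer n} :
    F ∈ fieldHomog n k ↔ ∀ c, F c ∈ homog (Coord n) ℝ k := by
  simp [fieldHomog]

theorem toC_radius (j : Fin n) : toC (radius j) = zc j * wc j := by
  simp only [radius, zc, wc, map_add, map_pow, map_X]
  linear_combination X (Sum.inr (Sum.inr j)) ^ 2 * C_I_mul (n := n)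

theorem xMono_zMono_self (a b : ℕ) (q : Fin n → ℕ) (f : CSer n) :
    xMono a b (f * zMono q q) = toC (rMono a q * X (.inl 1) ^ b) * f := by
  simp only [xMono, zMono, rMono, map_mul, map_pow, map_prod, toC_radius, map_X, mul_pow]
  ring

theorem adL_zField (ω : Fin n → ℝ) (j : Fin n) (f : CSer n) :
    adL ω (zField j (reS f) (imS f)) =
      zField j (reS (shiftOp ω (Complex.I * ω j) f)) (imS (shiftOp ω (Complex.I * ω j) f)) := by
  have h1 : reS (shiftOp ω (Complex.I * ω j) f) = der (lin ω) (reS f) - C (ω j) * imS f := by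
    rw [shiftOp_apply, map_add, reS_cder, reS_C_mul]
    simp
    ring
  have h2 : imS (shiftOp ω (Complex.I * ω j) f) = der (lin ω) (imS f) + C (ω j) * reS f := by
    rw [shiftOp_apply, map_add, imS_cder, imS_C_mul]
    simp
  rw [h1, h2]
  funext c
  rw [adL_apply]
  rcases c with i | k | k
  · simp [zField, linAct]
  · by_cases h : k = j <;> simp [zField, linAct, h]
  · by_cases h : k = j <;> simp [zField, linAct, h]

theorem adL_xField (ω : Fin n → ℝ) (f g : RSer n) :
    adL ω (xField f g) = xField (der (lin ω) f - g) (der (lin ω) g) := by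
  funext c
  rw [adL_apply]
  rcases c with i | k | k
  · by_cases h : i = 0 <;> simp [xField, linAct, h]
  · simp [xField, linAct]
  · simp [xField, linAct]

theorem zField_mem_fieldHomog {k : ℕ} (j : Fin n) {f g : RSer n} (hf : f ∈ homog (Coord n) ℝ k)
    (hg : g ∈ homog (Coord n) ℝ k) : zField j f g ∈ fieldHomog n k := by
  rw [mem_fieldHomog]
  rintro (i | c | c) <;> simp only [zField]
  · exact Submodule.zero_mem _
  · split_ifs
    exacts [hf, Submodule.zero_mem _]
  · split_ifs
    exacts [hg, Submodule.zero_mem _]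

theorem xField_mem_fieldHomog {k : ℕ} {f g : RSer n} (hf : f ∈ homog (Coord n) ℝ k)
    (hg : g ∈ homog (Coord n) ℝ k) : xField f g ∈ fieldHomog n k := by
  rw [mem_fieldHomog]
  rintro (i | c) <;> simp only [xField]
  · split_ifs
    exacts [hf, hg]
  · exact Submodule.zero_mem _

theorem zField_mem_span_resFields {k : ℕ} {j : Fin n} {f : CSer n}
    (hf : f ∈ Submodule.span ℂ (zRes n k j)) :
    zField j (reS f) (imS f) ∈ Submodule.span ℝ (resFields n k) := by
  suffices h : ∀ c : ℂ, zField j (reS (c • f)) (imS (c • f)) ∈ Submodule.span ℝ (resFields n k) by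
    simpa using h 1
  induction hf using Submodule.span_induction with
  | mem f hf =>
    obtain ⟨a, q, hk, rfl⟩ := hf
    intro c
    rw [xMono_zMono_self, smul_eq_C_mul, mul_left_comm, reS_toC_mul, imS_toC_mul, reS_C_mul,
      imS_C_mul, pow_zero, mul_one]
    have h1 : reS (zc j) = X (.inr (.inl j)) := by
      rw [zc, map_add, reS_C_mul, ← map_X (Complex.ofRealHom), ← map_X (Complex.ofRealHom),
        reS_toC, reS_toC, imS_toC]
      simp
    have h2 : imS (zc j) = X (.inr (.inr j)) := by
      rw [zc, map_add, imS_C_mul, ← map_X (Complex.ofRealHom), ← map_X (Complex.ofRealHom),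
        imS_toC, imS_toC, reS_toC]
      simp
    rw [h1, h2]
    have : zField j (rMono a q * (C c.re * X (.inr (.inl j)) - C c.im * X (.inr (.inr j))))
        (rMono a q * (C c.re * X (.inr (.inr j)) + C c.im * X (.inr (.inl j)))) =
        c.re • zField j (rMono a q * X (.inr (.inl j))) (rMono a q * X (.inr (.inr j))) +
        c.im • zField j (-(rMono a q * X (.inr (.inr j)))) (rMono a q * X (.inr (.inl j))) := by
      rw [zField_smul, zField_smul, zField_add]
      simp only [smul_eq_C_mul]
      congr 1 <;> ring
    rw [this]
    exact Submodule.add_mem _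
      (Submodule.smul_mem _ _ (Submodule.subset_span (Or.inr ⟨j, a, q, hk, Or.inl rfl⟩)))
      (Submodule.smul_mem _ _ (Submodule.subset_span (Or.inr ⟨j, a, q, hk, Or.inr rfl⟩)))
  | zero =>
    intro c
    rw [smul_zero, map_zero, map_zero]
    have := zField_smul j (0 : ℝ) (0 : RSer n) 0
    rw [zero_smul, zero_smul] at this
    rw [← this]
    exact Submodule.zero_mem _
  | add f g _ _ hf hg =>
    intro c
    rw [smul_add, map_add, map_add, ← zField_add]
    exact Submodule.add_mem _ (hf c) (hg c)
  | smul a f _ hf =>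
    intro c
    rw [smul_smul]
    exact hf _

theorem xField_mem_span_resFields {k : ℕ} {f : CSer n}
    (hf : f ∈ Submodule.span ℂ (xRes n k)) :
    xField 0 (reS f) ∈ Submodule.span ℝ (resFields n k) := by
  suffices h : ∀ c : ℂ, xField 0 (reS (c • f)) ∈ Submodule.span ℝ (resFields n k) by
    simpa using h 1
  induction hf using Submodule.span_induction with
  | mem f hf =>
    obtain ⟨a, b, q, hb, hk, rfl⟩ := hf
    intro c
    rw [← one_mul (zMono q q), xMono_zMono_self, smul_eq_C_mul, mul_one, reS_C_mul, reS_toC,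
      imS_toC, mul_zero, sub_zero, ← smul_eq_C_mul]
    have := xField_smul c.re (0 : RSer n) (rMono a q * X (Sum.inl 1) ^ b)
    rw [smul_zero] at this
    rw [← this]
    exact Submodule.smul_mem _ _ (Submodule.subset_span (Or.inl ⟨a, b, q, hb, hk, rfl⟩))
  | zero =>
    intro c
    rw [smul_zero, map_zero]
    have := xField_smul (0 : ℝ) (0 : RSer n) 0
    rw [zero_smul, zero_smul] at this
    rw [← this]
    exact Submodule.zero_mem _
  | add f g _ _ hf hg =>
    intro c
    rw [smul_add, map_add, ← add_zero (0 : RSer n), ← xField_add]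
    exact Submodule.add_mem _ (hf c) (hg c)
  | smul a f _ hf =>
    intro c
    rw [smul_smul]
    exact hf _

theorem fieldHomog_le {ω : Fin n → ℝ} (hω : LinearIndependent ℚ ω) (k : ℕ) :
    fieldHomog n k ≤ (fieldHomog n k).map (adL ω) ⊔ Submodule.span ℝ (resFields n k) := by
  intro F hF
  rw [mem_fieldHomog] at hF
  rw [field_decomp F]
  refine Submodule.add_mem _ ?_ (Submodule.sum_mem _ fun j _ => ?_)
  · have hD : der (lin ω) (F (.inl 0)) ∈ homog (Coord n) ℝ k :=
      homog_der (lin_mem_homog ω) (hF _)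
    obtain ⟨_, ⟨Q, hQ, rfl⟩, Y, hY, h⟩ := Submodule.mem_sup.1
      (homog_le_x hω k (toC_mem_homog (Submodule.add_mem _ (hF (.inl 1)) hD)))
    have h' := congrArg reS h
    rw [LinearMap.comp_apply, map_add, reS_toC, shiftOp_apply, shiftOp_apply] at h'
    simp only [map_zero, zero_mul, add_zero] at h'
    rw [reS_cder, reS_cder] at h'
    have e : xField (F (.inl 0)) (F (.inl 1)) =
        adL ω (xField (reS Q) (der (lin ω) (reS Q) - F (.inl 0))) + xField 0 (reS Y) := by
      rw [adL_xField, xField_add, map_sub]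
      congr 1
      · ring
      · linear_combination -h'
    rw [e]
    exact Submodule.add_mem _ (Submodule.mem_sup_left (Submodule.mem_map_of_mem
      (xField_mem_fieldHomog (reS_mem_homog hQ) (Submodule.sub_mem _
        (homog_der (lin_mem_homog ω) (reS_mem_homog hQ)) (hF _)))))
      (Submodule.mem_sup_right (xField_mem_span_resFields hY))
  · have hf : toC (F (.inr (.inl j))) + C Complex.I * toC (F (.inr (.inr j))) ∈
        homog (Coord n) ℂ k :=
      Submodule.add_mem _ (toC_mem_homog (hF _)) (homog_C_mul _ (toC_mem_homog (hF _)))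
    obtain ⟨_, ⟨Q, hQ, rfl⟩, Y, hY, h⟩ := Submodule.mem_sup.1 (homog_le_z hω k j hf)
    have h1 := congrArg reS h
    have h2 := congrArg imS h
    simp only [map_add, reS_toC, imS_toC, reS_C_mul, imS_C_mul, Complex.I_re, Complex.I_im,
      map_zero, map_one, zero_mul, one_mul, mul_zero, sub_zero, add_zero, zero_add] at h1 h2
    rw [← h1, ← h2, ← zField_add, ← adL_zField]
    exact Submodule.add_mem _ (Submodule.mem_sup_left (Submodule.mem_map_of_mem
      (zField_mem_fieldHomog j (reS_mem_homog hQ) (imS_mem_homog hQ))))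
      (Submodule.mem_sup_right (zField_mem_span_resFields hY))

end RealHomological

section Symmetrization

variable {σ : Type*}

theorem rescale_C (ε : σ → ℝ) (a : ℝ) : rescale ε (C a) = C a := by
  classical
  ext m
  rw [coeff_rescale, coeff_C]
  split_ifs with h
  · simp [h]
  · simp

theorem rescale_X (ε : σ → ℝ) (c : σ) :
    rescale ε (X c : MvPowerSeries σ ℝ) = C (ε c) * X c := by
  rw [rescale_eq_subst, subst_X (HasSubst.smul_X ε), Pi.smul_apply', smul_eq_C_mul]

theorem rescale_rescale_self {ε : σ → ℝ} (hε : ∀ c, ε c * ε c = 1) (f : MvPowerSeries σ ℝ) :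
    rescale ε (rescale ε f) = f := by
  rw [rescale_rescale, show ε * ε = 1 from funext hε, rescale_one, RingHom.id_apply]

/-- The projection onto the fields with the symmetry `SignSymm ε s`. -/
def symmProj (ε : σ → ℝ) (s : ℝ) :
    (σ → MvPowerSeries σ ℝ) →ₗ[ℝ] (σ → MvPowerSeries σ ℝ) where
  toFun F c := C (2⁻¹ : ℝ) * (F c + C (s * ε c) * rescale ε (F c))
  map_add' F G := by
    funext c
    simp only [Pi.add_apply, map_add]
    ring
  map_smul' a F := by
    funext c
    simp only [Pi.smul_apply, smul_eq_C_mul, map_mul, rescale_C, RingHom.id_apply]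
    ring

theorem symmProj_apply (ε : σ → ℝ) (s : ℝ) (F : σ → MvPowerSeries σ ℝ) (c : σ) :
    symmProj ε s F c = C (2⁻¹ : ℝ) * (F c + C (s * ε c) * rescale ε (F c)) := rfl

theorem C_mul_C_eq_one {a b : ℝ} (h : a * b = 1) : (C a * C b : MvPowerSeries σ ℝ) = 1 := by
  rw [← map_mul, h, map_one]

theorem C_half_mul_two : (C (2⁻¹ : ℝ) * 2 : MvPowerSeries σ ℝ) = 1 := by
  rw [← map_ofNat (C (σ := σ) (R := ℝ)) 2, ← map_mul]; simp

theorem signSymm_symmProj {ε : σ → ℝ} {s : ℝ} (hε : ∀ c, ε c * ε c = 1) (hs : s * s = 1)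
    (F : σ → MvPowerSeries σ ℝ) : SignSymm ε s (symmProj ε s F) := fun c => by
  rw [symmProj_apply, map_mul, map_add, map_mul, rescale_C, rescale_C, rescale_rescale_self hε]
  have : (C (s * ε c) * C (s * ε c) : MvPowerSeries σ ℝ) = 1 :=
    C_mul_C_eq_one (by linear_combination hε c * s * s + hs)
  linear_combination (-C (2⁻¹ : ℝ) * rescale ε (F c)) * this

theorem SignSymm.symmProj_eq {ε : σ → ℝ} {s : ℝ} (hε : ∀ c, ε c * ε c = 1) (hs : s * s = 1)
    {F : σ → MvPowerSeries σ ℝ} (hF : SignSymm ε s F) : symmProj ε s F = F := by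
  funext c
  have : (C (s * ε c) * C (s * ε c) : MvPowerSeries σ ℝ) = 1 :=
    C_mul_C_eq_one (by linear_combination hε c * s * s + hs)
  rw [symmProj_apply, hF c]
  linear_combination (C (2⁻¹ : ℝ) * F c) * this + F c * C_half_mul_two

theorem SignSymm.symmProj {ε ε' : σ → ℝ} {s s' : ℝ} {F : σ → MvPowerSeries σ ℝ}
    (hF : SignSymm ε s F) : SignSymm ε s (symmProj ε' s' F) := fun c => by
  have : rescale ε (rescale ε' (F c)) = C (s * ε c) * rescale ε' (F c) := by
    rw [rescale_rescale, mul_comm, ← rescale_rescale, hF c, map_mul, rescale_C]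
  rw [symmProj_apply, map_mul, map_add, map_mul, rescale_C, rescale_C, this, hF c]
  ring

theorem symmProj_of_rescale {ε : σ → ℝ} {s : ℝ} {F : σ → MvPowerSeries σ ℝ} {t : σ → ℝ}
    (h : ∀ c, rescale ε (F c) = C (t c) * F c) (c : σ) :
    symmProj ε s F c = C ((1 + s * ε c * t c) / 2) * F c := by
  have e : (C ((1 + s * ε c * t c) / 2) : MvPowerSeries σ ℝ) =
      (1 + C (s * ε c) * C (t c)) * C 2⁻¹ := by
    simp only [div_eq_mul_inv, map_mul, map_add, map_one]
  rw [symmProj_apply, h c, e]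
  ring

end Symmetrization

section Reversors

variable {n : ℕ}

/-- The signs by which the involution `psi a₀ a` multiplies the real coordinates. -/
def sgn (a₀ : ℝ) (a : Fin n → ℝ) : Coord n → ℝ
  | .inl i => if i = 0 then a₀ else -a₀
  | .inr (.inl j) => a j
  | .inr (.inr j) => -a j

theorem sgn_mul_self {a₀ : ℝ} {a : Fin n → ℝ} (h₀ : a₀ * a₀ = 1) (h : ∀ j, a j * a j = 1)
    (c : Coord n) : sgn a₀ a c * sgn a₀ a c = 1 := by
  rcases c with i | j | j
  · by_cases hi : i = 0 <;> simp [sgn, hi, h₀]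
  · simp [sgn, h]
  · simp [sgn, h]

theorem linAct_sgn (ω : Fin n → ℝ) (a₀ : ℝ) (a : Fin n → ℝ) (F : Coord n → RSer n) (c : Coord n) :
    linAct ω (fun c => C (sgn a₀ a c) * rescale (sgn a₀ a) (F c)) c =
      C (-sgn a₀ a c) * rescale (sgn a₀ a) (linAct ω F c) := by
  rcases c with i | j | j
  · by_cases h : i = 0 <;> simp [linAct, sgn, h]
  · simp only [linAct, sgn, map_mul, rescale_C, map_neg]
    ring
  · simp only [linAct, sgn, map_mul, rescale_C, map_neg]
    ring

theorem signSymm_lin (ω : Fin n → ℝ) {a₀ : ℝ} {a : Fin n → ℝ} (h₀ : a₀ * a₀ = 1)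
    (h : ∀ j, a j * a j = 1) : SignSymm (sgn a₀ a) (-1) (lin ω) := fun c => by
  have e : (fun c => C (sgn a₀ a c) * rescale (sgn a₀ a) (X c)) = (X : Coord n → RSer n) := by
    funext c
    rw [rescale_X, ← mul_assoc, C_mul_C_eq_one (sgn_mul_self h₀ h c), one_mul]
  have := linAct_sgn ω a₀ a X c
  rw [e] at this
  have h1 : (C (sgn a₀ a c) * C (sgn a₀ a c) : RSer n) = 1 :=
    C_mul_C_eq_one (sgn_mul_self h₀ h c)
  rw [map_neg] at this
  rw [lin, neg_one_mul, map_neg]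
  linear_combination C (sgn a₀ a c) * this - rescale (sgn a₀ a) (linAct ω X c) * h1

theorem symmProj_adL (ω : Fin n → ℝ) {a₀ : ℝ} {a : Fin n → ℝ} (h₀ : a₀ * a₀ = 1)
    (h : ∀ j, a j * a j = 1) (F : Coord n → RSer n) :
    symmProj (sgn a₀ a) (-1) (adL ω F) = adL ω (symmProj (sgn a₀ a) 1 F) := by
  have key : ∀ c, rescale (sgn a₀ a) (der (lin ω) (F c)) =
      -der (lin ω) (rescale (sgn a₀ a) (F c)) := fun c => by
    have := rescale_lieAlong (sgn_mul_self h₀ h) (signSymm_lin ω h₀ h) F c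
    rw [lieAlong, lieAlong, ← der_apply, ← der_apply] at this
    rw [this, map_neg, map_one, neg_one_mul]
  have hs : symmProj (sgn a₀ a) 1 F =
      (2⁻¹ : ℝ) • (F + fun c => C (sgn a₀ a c) * rescale (sgn a₀ a) (F c)) := by
    funext c
    rw [symmProj_apply, one_mul, Pi.smul_apply, smul_eq_C_mul]
    rfl
  have hd : ∀ (t : ℝ) (f : RSer n), der (lin ω) (C t * f) = C t * der (lin ω) f := fun t f => by
    rw [← smul_eq_C_mul, Derivation.map_smul, smul_eq_C_mul]
  funext c
  rw [hs, map_smul, map_add, symmProj_apply, Pi.smul_apply, smul_eq_C_mul, Pi.add_apply,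
    adL_apply, adL_apply, linAct_sgn, map_sub, key, hd, neg_one_mul]
  simp only [map_neg]
  ring

theorem symmProj_mem_fieldHomog {k : ℕ} {F : Coord n → RSer n} (hF : F ∈ fieldHomog n k)
    (ε : Coord n → ℝ) (s : ℝ) : symmProj ε s F ∈ fieldHomog n k := by
  rw [mem_fieldHomog] at *
  intro c
  exact homog_C_mul _ (Submodule.add_mem _ (hF c) (homog_C_mul _ (rescale_mem_homog ε (hF c))))

end Reversors

section NormalForm

variable {n : ℕ}

/-- The formal invariants `x₁^{1+δ}, |z₁|², …, |zₙ|²`. -/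
def invs (δ : ℕ) : Option (Fin n) → RSer n
  | none => X (.inl 0) ^ (1 + δ)
  | some j => radius j

/-- The degrees of the formal invariants. -/
def invWeight (n δ : ℕ) : Option (Fin n) → ℕ
  | none => 1 + δ
  | some _ => 2

theorem radius_mem_homog (j : Fin n) : radius j ∈ homog (Coord n) ℝ 2 :=
  Submodule.add_mem _ (homog_pow (homog_X _) 2) (homog_pow (homog_X _) 2)

theorem invs_mem_homog (δ : ℕ) (i : Option (Fin n)) :
    invs δ i ∈ homog (Coord n) ℝ (invWeight n δ i) := by
  cases i with
  | none => simpa [invs, invWeight] using homog_pow (homog_X (R := ℝ) (Sum.inl 0 : Coord n)) (1 + δ)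
  | some j => exact radius_mem_homog j

theorem invs_mem_ordIdeal (δ : ℕ) (i : Option (Fin n)) :
    invs δ i ∈ ordIdeal (Coord n) ℝ (invWeight n δ i) :=
  homog_le_ordIdeal (invs_mem_homog δ i)

theorem hasSubst_invs (δ : ℕ) : HasSubst (invs (n := n) δ) :=
  hasSubst_of_mem_ordIdeal fun i => ordIdeal_anti (by cases i <;> simp [invWeight])
    (invs_mem_ordIdeal δ i)

/-- The ring of real power series in the invariants. -/
abbrev ISer (n : ℕ) : Type := MvPowerSeries (Option (Fin n)) ℝ

/-- The nonlinear part of the formal normal form. -/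
def nfField (δ : ℕ) : (Option (Fin n) → ISer n) →ₗ[ℝ] (Coord n → RSer n) where
  toFun H
    | .inl i => if i = 0 then 0 else X (.inl 0) ^ δ * subst (invs δ) (H none)
    | .inr (.inl j) => -(X (.inr (.inr j)) * subst (invs δ) (H (some j)))
    | .inr (.inr j) => X (.inr (.inl j)) * subst (invs δ) (H (some j))
  map_add' H K := by
    have h := hasSubst_invs (n := n) δ
    funext c
    rcases c with i | j | j
    · by_cases hi : i = 0 <;> simp [hi, subst_add h, mul_add]
    · simp only [Pi.add_apply, subst_add h]; ring
    · simp only [Pi.add_apply, subst_add h]; ring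
  map_smul' a H := by
    have h := hasSubst_invs (n := n) δ
    funext c
    rcases c with i | j | j
    · by_cases hi : i = 0 <;> simp [hi, subst_smul h]
    · simp [subst_smul h]
    · simp [subst_smul h]

/-- The degree of the invariant component `i` of the normal form is offset by this number. -/
def offset (δ : ℕ) : Option (Fin n) → ℕ
  | none => δ
  | some _ => 1

/-- The normal form coefficients of degree `k`. -/
def nfHomog (n δ k : ℕ) : Submodule ℝ (Option (Fin n) → ISer n) where
  carrier := {H | ∀ i e, Finsupp.weight (invWeight n δ) e + offset δ i ≠ k → coeff e (H i) = 0}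
  add_mem' hf hg i e he := by rw [Pi.add_apply, map_add, hf i e he, hg i e he, add_zero]
  zero_mem' i e _ := by simp
  smul_mem' c f hf i e he := by rw [Pi.smul_apply, map_smul, hf i e he, smul_zero]

/-- The exponent with entries `a` and `q`. -/
def invExp (a : ℕ) (q : Fin n → ℕ) : Option (Fin n) →₀ ℕ :=
  Finsupp.equivFunOnFinite.symm fun i => i.elim a q

theorem monoAt_invExp (δ a : ℕ) (q : Fin n → ℕ) :
    monoAt (invs δ) (invExp a q) = rMono ((1 + δ) * a) q := by
  rw [monoAt, Finsupp.prod_fintype _ _ (by simp), Fintype.prod_option]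
  simp [invExp, invs, rMono, pow_mul]

theorem weight_invExp (δ a : ℕ) (q : Fin n → ℕ) :
    Finsupp.weight (invWeight n δ) (invExp a q) = (1 + δ) * a + 2 * ∑ i, q i := by
  rw [Finsupp.weight_apply, Finsupp.sum_fintype _ _ (by simp), Fintype.sum_option]
  simp [invExp, invWeight, Finset.sum_mul, mul_comm]

theorem subst_invs_monomial (δ a : ℕ) (q : Fin n → ℕ) :
    subst (invs δ) (monomial (invExp a q) (1 : ℝ)) = rMono ((1 + δ) * a) q := by
  rw [subst_monomial (hasSubst_invs δ), map_one, one_mul, ← monoAt_invExp]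
  rfl

theorem nf_x_mem (δ k a : ℕ) (q : Fin n → ℕ) (h : (1 + δ) * a + δ + 2 * ∑ i, q i = k) :
    xField 0 (rMono ((1 + δ) * a + δ) q) ∈ (nfHomog n δ k).map (nfField δ) := by
  refine ⟨Pi.single none (monomial (invExp a q) 1), ?_, ?_⟩
  · intro i e he
    cases i with
    | some j => simp
    | none =>
      rw [Pi.single_eq_same, coeff_monomial, if_neg]
      rintro rfl
      rw [weight_invExp, offset] at he
      omega
  · have h0 : subst (invs δ) (0 : ISer n) = (0 : RSer n) := by
      rw [← coe_substAlgHom (hasSubst_invs δ), map_zero]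
    funext c
    rcases c with i | j | j
    · by_cases hi : i = 0
      · simp [hi, xField, nfField]
      · simp only [nfField, LinearMap.coe_mk, AddHom.coe_mk, xField, if_neg hi, Pi.single_eq_same]
        rw [subst_invs_monomial, rMono, rMono, pow_add]
        ring
    · simp [nfField, xField, h0]
    · simp [nfField, xField, h0]

theorem nf_z_mem (δ k a : ℕ) (q : Fin n → ℕ) (j : Fin n) (h : (1 + δ) * a + 2 * ∑ i, q i + 1 = k) :
    zField j (-(rMono ((1 + δ) * a) q * X (.inr (.inr j))))
      (rMono ((1 + δ) * a) q * X (.inr (.inl j))) ∈ (nfHomog n δ k).map (nfField δ) := by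
  refine ⟨Pi.single (some j) (monomial (invExp a q) 1), ?_, ?_⟩
  · intro i e he
    by_cases hi : i = some j
    · subst hi
      rw [Pi.single_eq_same, coeff_monomial, if_neg]
      rintro rfl
      rw [weight_invExp, offset] at he
      omega
    · simp [hi]
  · have h0 : subst (invs δ) (0 : ISer n) = (0 : RSer n) := by
      rw [← coe_substAlgHom (hasSubst_invs δ), map_zero]
    funext c
    rcases c with i | k | k
    · by_cases hi : i = 0 <;> simp [hi, zField, nfField, h0]
    · by_cases hk : k = j
      · subst hk
        simp [nfField, zField, subst_invs_monomial, mul_comm]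
      · simp [nfField, zField, hk, h0]
    · by_cases hk : k = j
      · subst hk
        simp [nfField, zField, subst_invs_monomial, mul_comm]
      · simp [nfField, zField, hk, h0]

theorem rescale_rMono {a₀ : ℝ} {a : Fin n → ℝ} (h : ∀ j, a j * a j = 1) (m : ℕ)
    (q : Fin n → ℕ) : rescale (sgn a₀ a) (rMono m q) = C (a₀ ^ m) * rMono m q := by
  have hr : ∀ j, rescale (sgn a₀ a) (radius j) = radius j := by
    intro j
    have h2 : (C (a j) ^ 2 : RSer n) = 1 := by rw [← map_pow, pow_two, h, map_one]
    simp only [radius, map_add, map_pow, rescale_X, sgn, mul_pow, map_neg, neg_sq, h2, one_mul]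
  simp only [rMono, map_mul, map_pow, map_prod, hr, rescale_X, mul_pow, sgn, if_true, mul_assoc]

theorem symmProj_x_eq {a₀ : ℝ} {a : Fin n → ℝ} (h : ∀ j, a j * a j = 1) (m b : ℕ)
    (q : Fin n → ℕ) :
    symmProj (sgn a₀ a) (-1) (xField 0 (rMono m q * X (.inl 1) ^ b)) =
      ((1 + a₀ * (a₀ ^ m * (-a₀) ^ b)) / 2) • xField 0 (rMono m q * X (.inl 1) ^ b) := by
  funext c
  rw [symmProj_of_rescale (t := fun _ => a₀ ^ m * (-a₀) ^ b), Pi.smul_apply, smul_eq_C_mul]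
  · rcases c with i | c
    · by_cases hi : i = 0 <;> simp [xField, sgn, hi]
    · simp [xField]
  · intro c
    rcases c with i | c
    · by_cases hi : i = 0
      · simp [xField, hi]
      · simp only [xField, if_neg hi, map_mul, map_pow, rescale_rMono h, rescale_X, sgn]
        simp only [Fin.isValue, one_ne_zero, if_false, mul_pow, map_neg]
        ring
    · simp [xField]

theorem symmProj_z_sym_eq {a₀ : ℝ} {a : Fin n → ℝ} (h : ∀ j, a j * a j = 1) (m : ℕ)
    (q : Fin n → ℕ) (j : Fin n) :
    symmProj (sgn a₀ a) (-1)
        (zField j (rMono m q * X (.inr (.inl j))) (rMono m q * X (.inr (.inr j)))) =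
      ((1 - a₀ ^ m) / 2) • zField j (rMono m q * X (.inr (.inl j)))
        (rMono m q * X (.inr (.inr j))) := by
  funext c
  rw [symmProj_of_rescale (t := fun c => a₀ ^ m * sgn a₀ a c), Pi.smul_apply, smul_eq_C_mul]
  · rcases c with i | k | k
    · simp [zField]
    · by_cases hk : k = j
      · congr 2
        simp only [sgn]
        linear_combination (-a₀ ^ m / 2) * h k
      · simp [zField, hk]
    · by_cases hk : k = j
      · congr 2
        simp only [sgn]
        linear_combination (-a₀ ^ m / 2) * h k
      · simp [zField, hk]
  · intro c
    rcases c with i | k | k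
    · simp [zField]
    · by_cases hk : k = j
      · subst hk
        simp only [zField, if_true, map_mul, rescale_rMono h, rescale_X, sgn]
        ring
      · simp [zField, hk]
    · by_cases hk : k = j
      · subst hk
        simp only [zField, if_true, map_mul, rescale_rMono h, rescale_X, sgn]
        ring
      · simp [zField, hk]

theorem symmProj_z_rot_eq {a₀ : ℝ} {a : Fin n → ℝ} (h : ∀ j, a j * a j = 1) (m : ℕ)
    (q : Fin n → ℕ) (j : Fin n) :
    symmProj (sgn a₀ a) (-1)
        (zField j (-(rMono m q * X (.inr (.inr j)))) (rMono m q * X (.inr (.inl j)))) =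
      ((1 + a₀ ^ m) / 2) • zField j (-(rMono m q * X (.inr (.inr j))))
        (rMono m q * X (.inr (.inl j))) := by
  funext c
  rw [symmProj_of_rescale (t := fun c => -(a₀ ^ m * sgn a₀ a c)), Pi.smul_apply, smul_eq_C_mul]
  · rcases c with i | k | k
    · simp [zField]
    · by_cases hk : k = j
      · congr 2
        simp only [sgn]
        linear_combination (a₀ ^ m / 2) * h k
      · simp [zField, hk]
    · by_cases hk : k = j
      · congr 2
        simp only [sgn]
        linear_combination (a₀ ^ m / 2) * h k
      · simp [zField, hk]
  · intro c
    rcases c with i | k | k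
    · simp [zField]
    · by_cases hk : k = j
      · subst hk
        simp only [zField, if_true, map_neg, map_mul, rescale_rMono h, rescale_X, sgn]
        ring
      · simp [zField, hk]
    · by_cases hk : k = j
      · subst hk
        simp only [zField, if_true, map_neg, map_mul, rescale_rMono h, rescale_X, sgn]
        ring
      · simp [zField, hk]

theorem symmProj_resFields {a : Fin n → ℝ} (h : ∀ j, a j * a j = 1) {δ : ℕ}
    (hδ : δ = 0 ∨ δ = 1) (k : ℕ) :
    Submodule.span ℝ (resFields n k) ≤ ((nfHomog n δ k).map (nfField δ)).comap
      (symmProj (sgn ((-1) ^ δ) a) (-1) ∘ₗ symmProj (sgn 1 1) (-1)) := by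
  have h1 : ∀ j : Fin n, (1 : Fin n → ℝ) j * (1 : Fin n → ℝ) j = 1 := by simp
  refine Submodule.span_le.2 ?_
  rintro F (⟨m, b, q, hb, hk, rfl⟩ | ⟨j, m, q, hk, rfl | rfl⟩)
  · rw [SetLike.mem_coe, Submodule.mem_comap, LinearMap.comp_apply]
    rw [symmProj_x_eq h1, map_smul, symmProj_x_eq h]
    interval_cases b
    · refine Submodule.smul_mem _ _ ?_
      simp only [pow_zero, mul_one, add_zero] at hk ⊢
      rcases hδ with rfl | rfl
      · refine Submodule.smul_mem _ _ ?_
        simpa using nf_x_mem 0 k m q (by omega)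
      · rcases Nat.even_or_odd' m with ⟨t, rfl | rfl⟩
        · have : ((1 : ℝ) + (-1) ^ 1 * ((-1) ^ 1) ^ (2 * t)) / 2 = 0 := by
            rw [pow_mul]; norm_num
          rw [this, zero_smul]
          exact Submodule.zero_mem _
        · exact Submodule.smul_mem _ _ (nf_x_mem 1 k t q (by omega))
    · have : ((1 : ℝ) + 1 * (1 ^ m * (-1) ^ 1)) / 2 = 0 := by norm_num
      rw [this, zero_smul]
      exact Submodule.zero_mem _
  · rw [SetLike.mem_coe, Submodule.mem_comap, LinearMap.comp_apply]
    rw [symmProj_z_sym_eq h1, one_pow, sub_self, zero_div, zero_smul, map_zero]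
    exact Submodule.zero_mem _
  · rw [SetLike.mem_coe, Submodule.mem_comap, LinearMap.comp_apply]
    rw [symmProj_z_rot_eq h1, map_smul, symmProj_z_rot_eq h]
    refine Submodule.smul_mem _ _ ?_
    rcases hδ with rfl | rfl
    · refine Submodule.smul_mem _ _ ?_
      simpa using nf_z_mem 0 k m q j (by omega)
    · rcases Nat.even_or_odd' m with ⟨t, rfl | rfl⟩
      · exact Submodule.smul_mem _ _ (nf_z_mem 1 k t q j (by omega))
      · have : ((1 : ℝ) + ((-1) ^ 1) ^ (2 * t + 1)) / 2 = 0 := by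
          rw [pow_succ _ (2 * t), pow_mul]; norm_num
        rw [this, zero_smul]
        exact Submodule.zero_mem _

/-- The homological equation for bireversible fields. -/
theorem exists_homological_solution {ω : Fin n → ℝ} (hω : LinearIndependent ℚ ω) {a : Fin n → ℝ}
    (ha : ∀ j, a j * a j = 1) {δ : ℕ} (hδ : δ = 0 ∨ δ = 1) {k : ℕ} {R : Coord n → RSer n}
    (hR : R ∈ fieldHomog n k) (hφ : SignSymm (sgn 1 1) (-1) R)
    (hψ : SignSymm (sgn ((-1) ^ δ) a) (-1) R) :
    ∃ ξ ∈ fieldHomog n k, SignSymm (sgn 1 1) 1 ξ ∧ SignSymm (sgn ((-1) ^ δ) a) 1 ξ ∧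
      ∃ H ∈ nfHomog n δ k, R = adL ω ξ + nfField δ H := by
  have h1 : ∀ j : Fin n, (1 : Fin n → ℝ) j * (1 : Fin n → ℝ) j = 1 := by simp
  have h0 : ((-1 : ℝ) ^ δ) * (-1) ^ δ = 1 := by rw [← mul_pow]; simp
  obtain ⟨_, ⟨ξ, hξ, rfl⟩, Y, hY, h⟩ := Submodule.mem_sup.1 (fieldHomog_le hω k hR)
  obtain ⟨H, hH, hHY⟩ := symmProj_resFields ha hδ k hY
  refine ⟨symmProj (sgn ((-1) ^ δ) a) 1 (symmProj (sgn 1 1) 1 ξ),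
    symmProj_mem_fieldHomog (symmProj_mem_fieldHomog hξ _ _) _ _,
    (signSymm_symmProj (sgn_mul_self (by norm_num) h1) (by norm_num) _).symmProj,
    signSymm_symmProj (sgn_mul_self h0 ha) (by norm_num) _, H, hH, ?_⟩
  rw [← symmProj_adL ω h0 ha, ← symmProj_adL ω (by norm_num) h1, hHY, LinearMap.comp_apply,
    ← map_add, ← map_add, h, hφ.symmProj_eq (sgn_mul_self (by norm_num) h1) (by norm_num),
    hψ.symmProj_eq (sgn_mul_self h0 ha) (by norm_num)]

end NormalForm

section FormalNormalForm

variable {n : ℕ}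

/-- All terms of the normal form coefficients `H` of degree less than `p` vanish. -/
def VanishBelow (δ p : ℕ) (H : Option (Fin n) → ISer n) : Prop :=
  ∀ i e, Finsupp.weight (invWeight n δ) e + offset δ i < p → coeff e (H i) = 0

theorem VanishBelow.nfField_mem {δ p : ℕ} {H : Option (Fin n) → ISer n} (hH : VanishBelow δ p H)
    (c : Coord n) : nfField δ H c ∈ ordIdeal (Coord n) ℝ p := by
  have key : ∀ i, subst (invs δ) (H i) ∈ ordIdeal (Coord n) ℝ (p - offset δ i) := fun i =>
    subst_mem_ordIdeal_of_weight (hasSubst_invs δ) (invs_mem_ordIdeal δ)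
      fun d hd => hH i d (by omega)
  have hz : ∀ (c : Coord n) (j : Fin n), X c * subst (invs δ) (H (some j)) ∈
      ordIdeal (Coord n) ℝ p := fun c j =>
    ordIdeal_anti (by simp only [offset]; omega) (mul_mem_ordIdeal (X_mem_ordIdeal c) (key (some j)))
  rcases c with i | j | j
  · simp only [nfField, LinearMap.coe_mk, AddHom.coe_mk]
    split_ifs
    · exact Ideal.zero_mem _
    · have h1 : (X (.inl 0) : RSer n) ^ δ ∈ ordIdeal (Coord n) ℝ δ := by
        simpa using homog_le_ordIdeal (homog_pow (homog_X (R := ℝ) (Sum.inl 0 : Coord n)) δ)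
      exact ordIdeal_anti (by simp only [offset]; omega) (mul_mem_ordIdeal h1 (key none))
  · exact Ideal.neg_mem_iff _ |>.2 (hz _ j)
  · exact hz _ j

theorem signSymm_nfField {a₀ : ℝ} {a : Fin n → ℝ} (ha : ∀ j, a j * a j = 1) {δ : ℕ}
    (h1 : a₀ ^ (1 + δ) = 1) (H : Option (Fin n) → ISer n) :
    SignSymm (sgn a₀ a) (-1) (nfField δ H) := by
  have hr : ∀ i, rescale (sgn a₀ a) (invs δ i) = invs δ i := by
    intro i
    cases i with
    | none =>
      rw [invs, map_pow, rescale_X, mul_pow, ← map_pow]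
      simp only [sgn, if_true, h1, map_one, one_mul]
    | some j =>
      have := rescale_rMono (a₀ := a₀) ha 0 (Pi.single j 1)
      have e : rMono 0 (Pi.single j 1) = radius j := by
        rw [rMono, pow_zero, one_mul, Finset.prod_eq_single j]
        · simp
        · intro k _ hk; simp [hk]
        · simp
      rw [e, pow_zero, map_one, one_mul] at this
      exact this
  have hs : ∀ f, rescale (sgn a₀ a) (subst (invs δ) f) = subst (invs δ) f := fun f => by
    rw [rescale_subst _ (hasSubst_invs δ)]
    simp only [hr]
  intro c
  rcases c with i | j | j
  · by_cases hi : i = 0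
    · simp [nfField, hi]
    · simp only [nfField, LinearMap.coe_mk, AddHom.coe_mk, if_neg hi, map_mul, map_pow, rescale_X,
        hs, sgn, mul_pow, if_true]
      have e : (C a₀ ^ δ : RSer n) = C (-1) * C (-a₀) := by
        rw [← map_pow, ← map_mul]
        congr 1
        rw [neg_one_mul, neg_neg]
        have h3 : a₀ ^ δ * a₀ = 1 := by rw [← pow_succ, add_comm]; exact h1
        have h2 : a₀ ^ 2 = 1 := by
          have : |a₀| = 1 := (pow_eq_one_iff_of_nonneg (abs_nonneg a₀) (by omega : 1 + δ ≠ 0)).1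
            (by rw [← abs_pow, h1, abs_one])
          rw [← sq_abs, this, one_pow]
        linear_combination a₀ * h3 - a₀ ^ δ * h2
      rw [e]
      ring
  · simp only [nfField, LinearMap.coe_mk, AddHom.coe_mk, map_neg, map_mul, rescale_X, hs, sgn]
    simp [mul_assoc]
  · simp only [nfField, LinearMap.coe_mk, AddHom.coe_mk, map_neg, map_mul, rescale_X, hs, sgn]
    simp [mul_assoc]

/-- The failure of the formal map `Φ` to conjugate the field `V` to the normal form given
by `H`. -/
def defect (ω : Fin n → ℝ) (δ : ℕ) (V Φ : Coord n → RSer n) (H : Option (Fin n) → ISer n) :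
    Coord n → RSer n :=
  lieAlong V Φ - linAct ω Φ - fun c => subst Φ (nfField δ H c)

theorem lieAlong_add {V Φ Ψ : Coord n → RSer n} :
    lieAlong V (Φ + Ψ) = lieAlong V Φ + lieAlong V Ψ := by
  funext c
  simp only [lieAlong, Pi.add_apply, map_add, add_mul, Finset.sum_add_distrib]

theorem lieAlong_mem {V Φ : Coord n → RSer n} {k l : ℕ} (hV : ∀ c, V c ∈ ordIdeal (Coord n) ℝ l)
    (hΦ : ∀ c, Φ c ∈ ordIdeal (Coord n) ℝ (k + 1)) (c : Coord n) :
    lieAlong V Φ c ∈ ordIdeal (Coord n) ℝ (k + l) :=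
  Ideal.sum_mem _ fun d _ => mul_mem_ordIdeal (pderiv_mem_ordIdeal (hΦ c) d) (hV d)

theorem linAct_mem {ω : Fin n → ℝ} {Φ : Coord n → RSer n} {k : ℕ}
    (hΦ : ∀ c, Φ c ∈ ordIdeal (Coord n) ℝ k) (c : Coord n) :
    linAct ω Φ c ∈ ordIdeal (Coord n) ℝ k := by
  rcases c with i | j | j <;> simp only [linAct]
  · split_ifs
    exacts [hΦ _, Ideal.zero_mem _]
  · exact Ideal.mul_mem_left _ _ (hΦ _)
  · exact (Ideal.neg_mem_iff _).2 (Ideal.mul_mem_left _ _ (hΦ _))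

theorem mem_ordIdeal_one_of_sub_X {Φ : Coord n → RSer n} {c : Coord n}
    (h : Φ c - X c ∈ ordIdeal (Coord n) ℝ 2) : Φ c ∈ ordIdeal (Coord n) ℝ 1 := by
  have := add_mem (ordIdeal_anti (by omega : 1 ≤ 2) h) (X_mem_ordIdeal c)
  simpa using this

theorem subst_add_fields {Φ F G : Coord n → RSer n} (hΦ : HasSubst Φ) (c : Coord n) :
    subst Φ ((F + G) c) = subst Φ (F c) + subst Φ (G c) := by
  rw [Pi.add_apply, subst_add hΦ]

/-- The first order change of the defect. -/
theorem defect_add {ω : Fin n → ℝ} {δ k : ℕ} {V Φ ξ : Coord n → RSer n}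
    {H K : Option (Fin n) → ISer n} (hV : ∀ c, V c - lin ω c ∈ ordIdeal (Coord n) ℝ 2)
    (hΦ : ∀ c, Φ c - X c ∈ ordIdeal (Coord n) ℝ 2)
    (hξ : ∀ c, ξ c ∈ ordIdeal (Coord n) ℝ (k + 2)) (hH : VanishBelow δ 2 H)
    (hK : VanishBelow δ (k + 2) K) (c : Coord n) :
    defect ω δ V (Φ + ξ) (H + K) c - (defect ω δ V Φ H c + (adL ω ξ c - nfField δ K c)) ∈
      ordIdeal (Coord n) ℝ (k + 3) := by
  have hΦξ : ∀ c, (Φ + ξ) c - X c ∈ ordIdeal (Coord n) ℝ 2 := fun c => by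
    rw [Pi.add_apply, add_sub_right_comm]
    exact add_mem (hΦ c) (ordIdeal_anti (by omega) (hξ c))
  have h1 : ∀ c, Φ c ∈ ordIdeal (Coord n) ℝ 1 := fun c => mem_ordIdeal_one_of_sub_X (hΦ c)
  have h2 : ∀ c, (Φ + ξ) c ∈ ordIdeal (Coord n) ℝ 1 := fun c => mem_ordIdeal_one_of_sub_X (hΦξ c)
  have e : defect ω δ V (Φ + ξ) (H + K) c -
      (defect ω δ V Φ H c + (adL ω ξ c - nfField δ K c)) =
      lieAlong (fun c => V c - lin ω c) ξ c -
      (subst (Φ + ξ) (nfField δ H c) - subst Φ (nfField δ H c)) -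
      (subst (Φ + ξ) (nfField δ K c) - nfField δ K c) := by
    simp only [defect, Pi.sub_apply, lieAlong_add, linAct_add, map_add, adL_apply]
    rw [subst_add_fields (hasSubst_of_mem_ordIdeal h2), der_apply]
    simp only [lieAlong, Pi.add_apply, mul_sub, Finset.sum_sub_distrib]
    ring
  rw [e]
  refine sub_mem (sub_mem ?_ ?_) ?_
  · exact lieAlong_mem (k := k + 1) hV hξ c
  · have := subst_sub_subst_mem (q := k + 1) h2 h1 (fun c => by simpa using hξ c) (hH.nfField_mem c)
    exact ordIdeal_anti (by omega) this
  · exact subst_sub_self_mem (q := 1) hΦξ (hK.nfField_mem c)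

theorem defect_sub_mem {ω : Fin n → ℝ} {δ k : ℕ} {V Φ Φ' : Coord n → RSer n}
    {H H' : Option (Fin n) → ISer n} (hV : ∀ c, V c - lin ω c ∈ ordIdeal (Coord n) ℝ 2)
    (hΦ : ∀ c, Φ c - X c ∈ ordIdeal (Coord n) ℝ 2) (hH : VanishBelow δ 2 H)
    (hξ : ∀ c, Φ' c - Φ c ∈ ordIdeal (Coord n) ℝ (k + 2))
    (hK : VanishBelow δ (k + 2) (H' - H)) (c : Coord n) :
    defect ω δ V Φ' H' c - defect ω δ V Φ H c ∈ ordIdeal (Coord n) ℝ (k + 2) := by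
  have h := ordIdeal_anti (by omega : k + 2 ≤ k + 3) (defect_add (ξ := Φ' - Φ) hV hΦ hξ hH hK c)
  rw [add_sub_cancel, add_sub_cancel] at h
  have h2 : adL ω (Φ' - Φ) c - nfField δ (H' - H) c ∈ ordIdeal (Coord n) ℝ (k + 2) := by
    refine sub_mem ?_ (hK.nfField_mem c)
    rw [adL_apply, der_apply]
    exact sub_mem (lieAlong_mem (k := k + 1) (fun c => homog_le_ordIdeal (lin_mem_homog ω c)) hξ c)
      (linAct_mem hξ c)
  have := add_mem h h2
  ring_nf at this ⊢
  exact this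

/-- The pair `Φ`, `H` solves the conjugacy equation up to terms of degree `k + 2`. -/
structure IsApproxConj (ω : Fin n → ℝ) (δ : ℕ) (a : Fin n → ℝ) (V : Coord n → RSer n) (k : ℕ)
    (s : (Coord n → RSer n) × (Option (Fin n) → ISer n)) : Prop where
  near : ∀ c, s.1 c - X c ∈ ordIdeal (Coord n) ℝ 2
  low : VanishBelow δ 2 s.2
  symm_phi : SignSymm (sgn 1 1) 1 s.1
  symm_psi : SignSymm (sgn ((-1) ^ δ) a) 1 s.1
  defect_mem : ∀ c, defect ω δ V s.1 s.2 c ∈ ordIdeal (Coord n) ℝ (k + 2)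

theorem signSymm_X {ε : Coord n → ℝ} : SignSymm ε 1 (X : Coord n → RSer n) := fun c => by
  rw [rescale_X, one_mul]

theorem signSymm_linAct {ω : Fin n → ℝ} {a₀ : ℝ} {a : Fin n → ℝ} (h₀ : a₀ * a₀ = 1)
    (ha : ∀ j, a j * a j = 1) {Φ : Coord n → RSer n} (hΦ : SignSymm (sgn a₀ a) 1 Φ)
    (h : HasSubst Φ) : SignSymm (sgn a₀ a) (-1) (linAct ω Φ) := by
  have e : linAct ω Φ = fun c => subst Φ (lin ω c) := by
    funext c; rw [subst_lin ω h]
  rw [e]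
  exact (signSymm_lin ω h₀ ha).subst hΦ h

theorem signSymm_defect {ω : Fin n → ℝ} {δ : ℕ} {a₀ : ℝ} {a : Fin n → ℝ}
    (h₀ : a₀ * a₀ = 1) (h₁ : a₀ ^ (1 + δ) = 1) (ha : ∀ j, a j * a j = 1)
    {V Φ : Coord n → RSer n} (hV : SignSymm (sgn a₀ a) (-1) V) (hΦ : SignSymm (sgn a₀ a) 1 Φ)
    (h : HasSubst Φ) (H : Option (Fin n) → ISer n) :
    SignSymm (sgn a₀ a) (-1) (defect ω δ V Φ H) := by
  refine SignSymm.sub (SignSymm.sub ?_ (signSymm_linAct h₀ ha hΦ h))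
    ((signSymm_nfField ha h₁ H).subst hΦ h)
  have := hV.lieAlong (sgn_mul_self h₀ ha) hΦ
  rwa [mul_one] at this

theorem IsApproxConj.step {ω : Fin n → ℝ} (hω : LinearIndependent ℚ ω) {a : Fin n → ℝ}
    (ha : ∀ j, a j * a j = 1) {δ : ℕ} (hδ : δ = 0 ∨ δ = 1) {V : Coord n → RSer n}
    (hV : ∀ c, V c - lin ω c ∈ ordIdeal (Coord n) ℝ 2) (hφ : SignSymm (sgn 1 1) (-1) V)
    (hψ : SignSymm (sgn ((-1) ^ δ) a) (-1) V) {k : ℕ}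
    {s : (Coord n → RSer n) × (Option (Fin n) → ISer n)} (hs : IsApproxConj ω δ a V k s) :
    ∃ s', IsApproxConj ω δ a V (k + 1) s' ∧
      (∀ c, s'.1 c - s.1 c ∈ ordIdeal (Coord n) ℝ (k + 2)) ∧
      VanishBelow δ (k + 2) (s'.2 - s.2) := by
  have h1 : ∀ j : Fin n, (1 : Fin n → ℝ) j * (1 : Fin n → ℝ) j = 1 := by simp
  have h0 : ((-1 : ℝ) ^ δ) * (-1) ^ δ = 1 := by rw [← mul_pow]; simp
  have hδ' : ((-1 : ℝ) ^ δ) ^ (1 + δ) = 1 := by rcases hδ with rfl | rfl <;> norm_num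
  have hΦ : HasSubst s.1 := hasSubst_of_mem_ordIdeal fun c => mem_ordIdeal_one_of_sub_X (hs.near c)
  have hsymm : ∀ {ε : Coord n → ℝ}, SignSymm ε (-1) (defect ω δ V s.1 s.2) →
      SignSymm ε (-1) (fun c => homogPart (k + 2) (defect ω δ V s.1 s.2 c)) := fun h c => by
    rw [rescale_homogPart, h c, homogPart_C_mul]
  obtain ⟨ξ, hξ, hξφ, hξψ, K, hK, hR⟩ := exists_homological_solution hω ha hδ (k := k + 2)
    (R := fun c => homogPart (k + 2) (defect ω δ V s.1 s.2 c))
    (mem_fieldHomog.2 fun c => homogPart_mem _ _)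
    (hsymm (signSymm_defect (by norm_num) (by norm_num) h1 hφ hs.symm_phi hΦ _))
    (hsymm (signSymm_defect h0 hδ' ha hψ hs.symm_psi hΦ _))
  have hξ' : ∀ c, (-ξ) c ∈ ordIdeal (Coord n) ℝ (k + 2) := fun c =>
    (Ideal.neg_mem_iff _).2 (homog_le_ordIdeal (mem_fieldHomog.1 hξ c))
  have hK' : VanishBelow δ (k + 2) K := fun i e he => hK i e he.ne
  refine ⟨(s.1 + -ξ, s.2 + K), ⟨fun c => ?_, fun i e he => ?_, hs.symm_phi.add hξφ.neg,
    hs.symm_psi.add hξψ.neg, fun c => ?_⟩, fun c => ?_, ?_⟩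
  · have := add_mem (hs.near c) (ordIdeal_anti (by omega : 2 ≤ k + 2) (hξ' c))
    rwa [← add_sub_right_comm] at this
  · change coeff e ((s.2 + K) i) = 0
    rw [Pi.add_apply, map_add, hs.low i e he, hK' i e (by omega), add_zero]
  · have hd := defect_add hV hs.near hξ' hs.low hK' c
    have hR' := sub_homogPart_mem (hs.defect_mem c)
    have hc := congrFun hR c
    simp only [Pi.add_apply] at hc
    rw [hc] at hR'
    have hn : adL ω (-ξ) c = -adL ω ξ c := by rw [map_neg]; rfl
    rw [hn] at hd
    have := add_mem hd hR'
    have e : ∀ A B a b : RSer n, A - (B + (-a - b)) + (B - (a + b)) = A := fun A B a b => by ring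
    rwa [e] at this
  · simpa using hξ' c
  · simpa using hK'

/-- Formal normal form of bireversible formal fields. -/
theorem exists_formal_normal_form {ω : Fin n → ℝ} (hω : LinearIndependent ℚ ω) {a : Fin n → ℝ}
    (ha : ∀ j, a j * a j = 1) {δ : ℕ} (hδ : δ = 0 ∨ δ = 1) {V : Coord n → RSer n}
    (hV : ∀ c, V c - lin ω c ∈ ordIdeal (Coord n) ℝ 2) (hφ : SignSymm (sgn 1 1) (-1) V)
    (hψ : SignSymm (sgn ((-1) ^ δ) a) (-1) V) :
    ∃ (Φ : Coord n → RSer n) (H : Option (Fin n) → ISer n),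
      (∀ c, Φ c - X c ∈ ordIdeal (Coord n) ℝ 2) ∧ VanishBelow δ 2 H ∧
      ∀ c, ∑ d, pderiv ℝ d (Φ c) * V d = subst Φ (lin ω c + nfField δ H c) := by
  have start : IsApproxConj ω δ a V 0 (X, 0) := by
    refine ⟨fun c => by simp, fun i e _ => by simp, signSymm_X, signSymm_X, fun c => ?_⟩
    have e : defect ω δ V X 0 c = V c - lin ω c := by
      simp only [defect, map_zero, Pi.sub_apply, Pi.zero_apply, lieAlong]
      rw [← der_apply, der_X, subst_self, id, sub_zero, lin]
    rw [e]
    exact hV c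
  choose f hf hf1 hf2 using fun (k : ℕ) (s : {s // IsApproxConj ω δ a V k s}) =>
    s.2.step hω ha hδ hV hφ hψ
  let seq : ∀ k, {s // IsApproxConj ω δ a V k s} := fun k =>
    Nat.rec ⟨_, start⟩ (fun k s => ⟨f k s, hf k s⟩) k
  have hseq : ∀ k, (seq (k + 1)).1 = f k (seq k) := fun k => rfl
  have stable : ∀ (u : ℕ → ℝ) (d : ℕ), (∀ j, d < j + 2 → u (j + 1) = u j) →
      ∀ k, d < k + 2 → u d = u k := by
    intro u d hu
    have mono : ∀ k, d < k + 2 → ∀ i, u (k + i) = u k := by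
      intro k hk i
      induction i with
      | zero => rfl
      | succ i ih => rw [← add_assoc, hu _ (by omega), ih]
    intro k hk
    rcases le_total k d with h | h
    · obtain ⟨i, rfl⟩ := Nat.exists_eq_add_of_le h
      exact mono k hk i
    · obtain ⟨i, rfl⟩ := Nat.exists_eq_add_of_le h
      exact (mono d (by omega) i).symm
  let Φ : Coord n → RSer n := fun c m => coeff m ((seq m.degree).1.1 c)
  let H : Option (Fin n) → ISer n := fun i e =>
    coeff e ((seq (Finsupp.weight (invWeight n δ) e + offset δ i)).1.2 i)
  have hΦ : ∀ k c, Φ c - (seq k).1.1 c ∈ ordIdeal (Coord n) ℝ (k + 2) := by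
    intro k c
    rw [mem_ordIdeal]
    intro m hm
    rw [map_sub, sub_eq_zero]
    refine stable (fun k => coeff m ((seq k).1.1 c)) m.degree (fun j hj => ?_) k hm
    have := mem_ordIdeal.1 (hf1 j (seq j) c) m hj
    rwa [map_sub, sub_eq_zero] at this
  have hH : ∀ k, VanishBelow δ (k + 2) (H - (seq k).1.2) := by
    intro k i e he
    rw [Pi.sub_apply, map_sub, sub_eq_zero]
    refine stable (fun k => coeff e ((seq k).1.2 i)) _ (fun j hj => ?_) k he
    have := hf2 j (seq j) i e hj
    rwa [Pi.sub_apply, map_sub, sub_eq_zero] at this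
  have near : ∀ c, Φ c - X c ∈ ordIdeal (Coord n) ℝ 2 := fun c => by
    have := add_mem (hΦ 0 c) ((seq 0).2.near c)
    rwa [sub_add_sub_cancel] at this
  have hsub : HasSubst Φ := hasSubst_of_mem_ordIdeal fun c => mem_ordIdeal_one_of_sub_X (near c)
  refine ⟨Φ, H, near, fun i e he => ?_, fun c => ?_⟩
  · have h1 := hH 0 i e he
    have h2 := (seq 0).2.low i e he
    rwa [Pi.sub_apply, map_sub, h2, sub_zero] at h1
  · have h0 : defect ω δ V Φ H c = 0 := eq_zero_of_forall_mem_ordIdeal fun k => by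
      have h1 := defect_sub_mem hV (seq k).2.near (seq k).2.low (hΦ k) (hH k) c
      have h2 := add_mem h1 ((seq k).2.defect_mem c)
      rw [sub_add_cancel] at h2
      exact ordIdeal_anti (by omega) h2
    rw [subst_add hsub, subst_lin ω hsub]
    have e : defect ω δ V Φ H c = ∑ d, pderiv ℝ d (Φ c) * V d - linAct ω Φ c -
      subst Φ (nfField δ H c) := rfl
    rw [e] at h0
    linear_combination h0

end FormalNormalForm

section Jets

variable {E F ι κ : Type*} [NormedAddCommGroup E] [NormedSpace ℝ E]
  [NormedAddCommGroup F] [NormedSpace ℝ F]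

/-- The derivative of `f` in the direction `v`. -/
def dirD (v : E) (f : E → ℝ) (x : E) : ℝ := fderiv ℝ f x v

theorem contDiff_dirD (v : E) {f : E → ℝ} (hf : ContDiff ℝ (⊤ : ℕ∞) f) :
    ContDiff ℝ (⊤ : ℕ∞) (dirD v f) :=
  (hf.fderiv_right (m := (⊤ : ℕ∞)) (by simp)).clm_apply contDiff_const

theorem smooth_differentiableAt {f : E → F} (hf : ContDiff ℝ (⊤ : ℕ∞) f) (x : E) :
    DifferentiableAt ℝ f x :=
  (hf.differentiable (by simp)) x

theorem dirD_comm (v w : E) {f : E → ℝ} (hf : ContDiff ℝ (⊤ : ℕ∞) f) :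
    dirD v (dirD w f) = dirD w (dirD v f) := by
  have h : ∀ (v w : E) (x : E), dirD v (dirD w f) x = fderiv ℝ (fderiv ℝ f) x v w := by
    intro v w x
    have hd : DifferentiableAt ℝ (fderiv ℝ f) x :=
      smooth_differentiableAt (hf.fderiv_right (m := (⊤ : ℕ∞)) (by simp)) x
    change fderiv ℝ (fun y => fderiv ℝ f y w) x v = _
    rw [fderiv_clm_apply hd (differentiableAt_const w)]
    simp
  funext x
  rw [h, h]
  exact (hf.contDiffAt.isSymmSndFDerivAt
    (by rw [minSmoothness_of_isRCLikeNormedField]; exact ENat.LEInfty.out)) v w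

/-- The iterated derivative of `f` in the directions listed by `l`. -/
def iterD (b : ι → E) (l : List ι) (f : E → ℝ) : E → ℝ := l.foldr (fun c g => dirD (b c) g) f

theorem contDiff_iterD (b : ι → E) (l : List ι) {f : E → ℝ} (hf : ContDiff ℝ (⊤ : ℕ∞) f) :
    ContDiff ℝ (⊤ : ℕ∞) (iterD b l f) := by
  induction l with
  | nil => exact hf
  | cons c l ih => exact contDiff_dirD _ ih

theorem iterD_dirD (b : ι → E) (l : List ι) (v : E) {f : E → ℝ} (hf : ContDiff ℝ (⊤ : ℕ∞) f) :
    iterD b l (dirD v f) = dirD v (iterD b l f) := by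
  induction l with
  | nil => rfl
  | cons c l ih =>
    change dirD (b c) (iterD b l (dirD v f)) = dirD v (dirD (b c) (iterD b l f))
    rw [ih, dirD_comm _ _ (contDiff_iterD b l hf)]

theorem iterD_perm (b : ι → E) {l l' : List ι} (h : l.Perm l') {f : E → ℝ}
    (hf : ContDiff ℝ (⊤ : ℕ∞) f) : iterD b l f = iterD b l' f := by
  induction h with
  | nil => rfl
  | cons c _ ih => exact congrArg (dirD (b c)) ih
  | swap c d l => exact dirD_comm _ _ (contDiff_iterD b l hf)
  | trans _ _ ih ih' => exact ih.trans ih'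

theorem iteratedFDeriv_eq_iterD (b : ι → E) (l : List ι) {f : E → ℝ}
    (hf : ContDiff ℝ (⊤ : ℕ∞) f) (x : E) :
    iteratedFDeriv ℝ l.length f x (fun k => b (l.get k)) = iterD b l f x := by
  induction l generalizing x with
  | nil => simp [iterD]
  | cons c l ih =>
    have hd : DifferentiableAt ℝ (iteratedFDeriv ℝ l.length f) x :=
      (hf.differentiable_iteratedFDeriv (m := l.length)
        (by exact_mod_cast WithTop.coe_lt_top _)) x
    have e : iterD b l f = fun y => iteratedFDeriv ℝ l.length f y (fun k => b (l.get k)) :=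
      funext fun y => (ih y).symm
    change _ = fderiv ℝ (iterD b l f) x (b c)
    rw [e]
    have := (ContinuousMultilinearMap.apply ℝ (fun _ : Fin l.length => E) ℝ
      (fun k => b (l.get k))).hasFDerivAt.comp x hd.hasFDerivAt
    have h2 := this.fderiv
    change fderiv ℝ (fun y => iteratedFDeriv ℝ l.length f y (fun k => b (l.get k))) x = _ at h2
    rw [h2]
    rfl

variable [Fintype ι]

/-- The Taylor series of `f` at the origin with respect to the directions `b`. -/
def jet (b : ι → E) (f : E → ℝ) : MvPowerSeries ι ℝ := fun m =>
  (∏ c, ((m c)! : ℝ))⁻¹ *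
    iteratedFDeriv ℝ (Finsupp.toMultiset m).toList.length f 0
      (fun k => b ((Finsupp.toMultiset m).toList.get k))

theorem taylorSeries_eq_jet {n : ℕ} (f : Phase n → ℝ) : taylorSeries f = jet unitVec f := rfl

theorem coeff_jet (b : ι → E) {f : E → ℝ} (hf : ContDiff ℝ (⊤ : ℕ∞) f) (m : ι →₀ ℕ) :
    coeff m (jet b f) =
      (∏ c, ((m c)! : ℝ))⁻¹ * iterD b (Finsupp.toMultiset m).toList f 0 := by
  rw [← iteratedFDeriv_eq_iterD b _ hf]
  rfl

theorem constantCoeff_jet (b : ι → E) {f : E → ℝ} (hf : ContDiff ℝ (⊤ : ℕ∞) f) :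
    constantCoeff (jet b f) = f 0 := by
  rw [← coeff_zero_eq_constantCoeff_apply, coeff_jet b hf]
  simp [iterD]

theorem pderiv_jet (b : ι → E) {f : E → ℝ} (hf : ContDiff ℝ (⊤ : ℕ∞) f) (c : ι) :
    pderiv ℝ c (jet b f) = jet b (dirD (b c) f) := by
  classical
  ext m
  rw [coeff_pderiv, coeff_jet b hf, coeff_jet b (contDiff_dirD _ hf), iterD_dirD b _ _ hf]
  have hp : (Finsupp.toMultiset (m + Finsupp.single c 1)).toList.Perm
      (c :: (Finsupp.toMultiset m).toList) := by
    rw [← Multiset.coe_eq_coe, Multiset.coe_toList, ← Multiset.cons_coe, Multiset.coe_toList,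
      map_add, Finsupp.toMultiset_single, one_smul, add_comm, Multiset.singleton_add]
  rw [iterD_perm b hp hf]
  have hfac : (∏ d, (((m + Finsupp.single c 1 : ι →₀ ℕ) d)! : ℝ)) = (m c + 1) * ∏ d, ((m d)! : ℝ) := by
    rw [← Finset.mul_prod_erase _ _ (Finset.mem_univ c),
      ← Finset.mul_prod_erase _ (fun d => ((m d)! : ℝ)) (Finset.mem_univ c), ← mul_assoc]
    congr 1
    · simp [Nat.factorial_succ]
    · refine Finset.prod_congr rfl fun d hd => ?_
      rw [Finsupp.add_apply, Finsupp.single_eq_of_ne (Finset.ne_of_mem_erase hd), add_zero]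
  rw [hfac]
  have h1 : (m c + 1 : ℝ) ≠ 0 := by positivity
  have h2 : (∏ d, ((m d)! : ℝ)) ≠ 0 := Finset.prod_ne_zero_iff.2 fun d _ => by positivity
  change _ * dirD (b c) (iterD b _ f) 0 * _ = _
  field_simp

theorem mem_ordIdeal_succ {k : ℕ} {f : MvPowerSeries ι ℝ} (h0 : constantCoeff f = 0)
    (h : ∀ c, pderiv ℝ c f ∈ ordIdeal ι ℝ k) : f ∈ ordIdeal ι ℝ (k + 1) := by
  classical
  rw [mem_ordIdeal]
  intro m hm
  by_cases hm0 : m = 0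
  · rw [hm0]; exact h0
  · obtain ⟨c, hc⟩ : ∃ c, m c ≠ 0 := by
      by_contra hh
      push Not at hh
      exact hm0 (Finsupp.ext hh)
    obtain ⟨m', rfl⟩ : ∃ m', m = m' + Finsupp.single c 1 := by
      refine ⟨m - Finsupp.single c 1, (tsub_add_cancel_of_le ?_).symm⟩
      rw [Finsupp.single_le_iff]
      omega
    have := mem_ordIdeal.1 (h c) m' (by simpa using hm)
    rw [coeff_pderiv] at this
    exact (mul_eq_zero.1 this).resolve_right (by positivity)

theorem jet_add (b : ι → E) {f g : E → ℝ} (hf : ContDiff ℝ (⊤ : ℕ∞) f)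
    (hg : ContDiff ℝ (⊤ : ℕ∞) g) : jet b (fun x => f x + g x) = jet b f + jet b g := by
  ext m
  change _ * iteratedFDeriv ℝ _ (f + g) 0 _ = _ * _ + _ * _
  rw [iteratedFDeriv_add_apply (hf.contDiffAt.of_le (by exact_mod_cast le_top))
    (hg.contDiffAt.of_le (by exact_mod_cast le_top)), _root_.add_apply, mul_add]

theorem jet_const (b : ι → E) (a : ℝ) : jet b (fun _ => a) = C a := by
  refine pderiv.ext (fun c => ?_) ?_
  · rw [pderiv_jet b contDiff_const, pderiv_C]
    have : dirD (b c) (fun _ : E => a) = fun _ => 0 := by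
      funext x; simp [dirD]
    rw [this]
    ext m
    rw [coeff_jet b contDiff_const]
    have h0 : ∀ l : List ι, iterD b l (fun _ : E => (0 : ℝ)) = fun _ => 0 := by
      intro l
      induction l with
      | nil => rfl
      | cons c l ih =>
        change dirD (b c) (iterD b l _) = _
        rw [ih]; funext x; simp [dirD]
    rw [h0, mul_zero, map_zero]
  · rw [constantCoeff_jet b contDiff_const, constantCoeff_C]

theorem jet_mul (b : ι → E) {f g : E → ℝ} (hf : ContDiff ℝ (⊤ : ℕ∞) f)
    (hg : ContDiff ℝ (⊤ : ℕ∞) g) : jet b (fun x => f x * g x) = jet b f * jet b g := by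
  rw [← sub_eq_zero]
  refine eq_zero_of_forall_mem_ordIdeal fun k => ?_
  induction k generalizing f g with
  | zero => exact mem_ordIdeal_zero _
  | succ k ih =>
    have hfg : ContDiff ℝ (⊤ : ℕ∞) fun x => f x * g x := hf.mul hg
    refine mem_ordIdeal_succ ?_ fun c => ?_
    · rw [map_sub, map_mul, constantCoeff_jet b hfg, constantCoeff_jet b hf,
        constantCoeff_jet b hg, sub_self]
    · have e : dirD (b c) (fun x => f x * g x) =
          fun x => f x * dirD (b c) g x + g x * dirD (b c) f x := by
        funext x
        simp only [dirD]
        rw [fderiv_fun_mul (smooth_differentiableAt hf x) (smooth_differentiableAt hg x)]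
        simp
      have hf' := contDiff_dirD (b c) hf
      have hg' := contDiff_dirD (b c) hg
      rw [map_sub, pderiv_jet b hfg, e, jet_add b (hf.mul hg') (hg.mul hf'), Derivation.leibniz,
        pderiv_jet b hf, pderiv_jet b hg, smul_eq_mul, smul_eq_mul, add_sub_add_comm]
      exact add_mem (ih hf hg') (ih hg hf')

theorem jet_clm (b : ι → E) (L : E →L[ℝ] ℝ) : jet b L = ∑ c, C (L (b c)) * X c := by
  classical
  refine pderiv.ext (fun c => ?_) ?_
  · have : dirD (b c) L = fun _ => L (b c) := by
      funext x; simp [dirD]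
    rw [pderiv_jet b L.contDiff, this, jet_const, map_sum, Finset.sum_eq_single c]
    · rw [← smul_eq_C_mul, Derivation.map_smul, pderiv_X_self, smul_eq_C_mul, mul_one]
    · intro d _ hd
      rw [← smul_eq_C_mul, Derivation.map_smul, pderiv_X_of_ne hd, smul_zero]
    · simp
  · rw [constantCoeff_jet b L.contDiff]
    simp

theorem jet_smul (b : ι → E) (a : ℝ) {f : E → ℝ} (hf : ContDiff ℝ (⊤ : ℕ∞) f) :
    jet b (fun x => a * f x) = C a * jet b f := by
  rw [jet_mul b contDiff_const hf, jet_const]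

theorem jet_sub (b : ι → E) {f g : E → ℝ} (hf : ContDiff ℝ (⊤ : ℕ∞) f)
    (hg : ContDiff ℝ (⊤ : ℕ∞) g) : jet b (fun x => f x - g x) = jet b f - jet b g := by
  have : (fun x => f x - g x) = fun x => f x + (-1) * g x := by funext x; ring
  rw [this, jet_add b hf (contDiff_const.mul hg), jet_smul b _ hg]
  simp [sub_eq_add_neg]

theorem jet_neg (b : ι → E) {f : E → ℝ} (hf : ContDiff ℝ (⊤ : ℕ∞) f) :
    jet b (fun x => -f x) = -jet b f := by
  have : (fun x => -f x) = fun x => (-1) * f x := by funext x; ring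
  rw [this, jet_smul b _ hf]
  simp

theorem jet_pow (b : ι → E) {f : E → ℝ} (hf : ContDiff ℝ (⊤ : ℕ∞) f) (k : ℕ) :
    jet b (fun x => f x ^ k) = jet b f ^ k := by
  induction k with
  | zero => simp [jet_const]
  | succ k ih => simp only [pow_succ]; rw [jet_mul b (hf.pow k) hf, ih]

theorem jet_sum (b : ι → E) {α : Type*} (s : Finset α) {f : α → E → ℝ}
    (hf : ∀ i, ContDiff ℝ (⊤ : ℕ∞) (f i)) :
    jet b (fun x => ∑ i ∈ s, f i x) = ∑ i ∈ s, jet b (f i) := by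
  classical
  induction s using Finset.induction_on with
  | empty => simp [jet_const]
  | insert a s ha ih =>
    simp only [Finset.sum_insert ha]
    rw [jet_add b (hf a) (ContDiff.sum fun i _ => hf i), ih]

theorem contDiff_mvPolynomial_eval {u : κ → E → ℝ} (hu : ∀ i, ContDiff ℝ (⊤ : ℕ∞) (u i))
    (p : MvPolynomial κ ℝ) :
    ContDiff ℝ (⊤ : ℕ∞) fun x => MvPolynomial.eval (fun i => u i x) p := by
  induction p using MvPolynomial.induction_on with
  | C a => simpa using contDiff_const
  | add p q hp hq => simpa using hp.add hq
  | mul_X p i hp => simpa using hp.mul (hu i)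

theorem jet_mvPolynomial_eval (b : ι → E) {u : κ → E → ℝ}
    (hu : ∀ i, ContDiff ℝ (⊤ : ℕ∞) (u i)) (p : MvPolynomial κ ℝ) :
    jet b (fun x => MvPolynomial.eval (fun i => u i x) p) =
      MvPolynomial.aeval (fun i => jet b (u i)) p := by
  induction p using MvPolynomial.induction_on with
  | C a => simp [jet_const, MvPowerSeries.algebraMap_apply]
  | add p q hp hq =>
    simp only [map_add]
    rw [jet_add b (contDiff_mvPolynomial_eval hu p) (contDiff_mvPolynomial_eval hu q), hp, hq]
  | mul_X p i hp =>
    simp only [map_mul, MvPolynomial.eval_X, MvPolynomial.aeval_X]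
    rw [jet_mul b (contDiff_mvPolynomial_eval hu p) (hu i), hp]

variable [Fintype κ]

theorem jet_comp_mem (b : ι → E) (b' : κ → F) {u : κ → E → ℝ}
    (hu : ∀ i, ContDiff ℝ (⊤ : ℕ∞) (u i)) (hu0 : ∀ i, u i 0 = 0) {k : ℕ} {h : F → ℝ}
    (hh : ContDiff ℝ (⊤ : ℕ∞) h) (hk : jet b' h ∈ ordIdeal κ ℝ k) :
    jet b (fun x => h (∑ i, u i x • b' i)) ∈ ordIdeal ι ℝ k := by
  have hq : ContDiff ℝ (⊤ : ℕ∞) fun x => ∑ i, u i x • b' i :=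
    ContDiff.sum fun i _ => (hu i).smul contDiff_const
  induction k generalizing h with
  | zero => exact mem_ordIdeal_zero _
  | succ k ih =>
    have hc : ContDiff ℝ (⊤ : ℕ∞) fun x => h (∑ i, u i x • b' i) := hh.comp hq
    refine mem_ordIdeal_succ ?_ fun c => ?_
    · rw [constantCoeff_jet b hc]
      simp only [hu0, zero_smul, Finset.sum_const_zero]
      rw [← constantCoeff_jet b' hh]
      exact mem_ordIdeal_one.1 (ordIdeal_anti (by omega) hk)
    · have e : dirD (b c) (fun x => h (∑ i, u i x • b' i)) =
          fun x => ∑ j, dirD (b' j) h (∑ i, u i x • b' i) * dirD (b c) (u j) x := by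
        funext x
        have h1 : HasFDerivAt (fun x => ∑ i, u i x • b' i)
            (∑ i, (fderiv ℝ (u i) x).smulRight (b' i)) x :=
          HasFDerivAt.fun_sum fun i _ => (smooth_differentiableAt (hu i) x).hasFDerivAt.smul_const _
        have h2 := ((smooth_differentiableAt hh _).hasFDerivAt.comp x h1).fderiv
        simp only [dirD]
        change fderiv ℝ (h ∘ fun x => ∑ i, u i x • b' i) x (b c) = _
        rw [h2]
        simp [mul_comm]
      have hd : ∀ j, ContDiff ℝ (⊤ : ℕ∞) fun x => dirD (b' j) h (∑ i, u i x • b' i) :=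
        fun j => (contDiff_dirD _ hh).comp hq
      rw [pderiv_jet b hc, e, jet_sum b _ fun j => (hd j).mul (contDiff_dirD _ (hu j))]
      refine Ideal.sum_mem _ fun j _ => ?_
      rw [jet_mul b (hd j) (contDiff_dirD _ (hu j))]
      refine Ideal.mul_mem_right _ _ (ih (contDiff_dirD _ hh) ?_)
      rw [← pderiv_jet b' hh]
      exact pderiv_mem_ordIdeal hk j

/-- The Taylor series of a composition. -/
theorem jet_comp (b : ι → E) (b' : κ → F) {ℓ : κ → F →L[ℝ] ℝ} (hℓ : ∀ i, jet b' (ℓ i) = X i)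
    {u : κ → E → ℝ} (hu : ∀ i, ContDiff ℝ (⊤ : ℕ∞) (u i)) (hu0 : ∀ i, u i 0 = 0)
    (hℓu : ∀ i x, ℓ i (∑ i, u i x • b' i) = u i x) {h : F → ℝ} (hh : ContDiff ℝ (⊤ : ℕ∞) h) :
    jet b (fun x => h (∑ i, u i x • b' i)) = subst (fun i => jet b (u i)) (jet b' h) := by
  have hu1 : ∀ i, jet b (u i) ∈ ordIdeal ι ℝ 1 := fun i => by
    rw [mem_ordIdeal_one, constantCoeff_jet b (hu i), hu0]
  have hs := hasSubst_of_mem_ordIdeal hu1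
  have hq : ContDiff ℝ (⊤ : ℕ∞) fun x => ∑ i, u i x • b' i :=
    ContDiff.sum fun i _ => (hu i).smul contDiff_const
  rw [← sub_eq_zero]
  refine eq_zero_of_forall_mem_ordIdeal fun k => ?_
  let p := truncTotal k (jet b' h)
  have hp : jet b' h - (p : MvPowerSeries κ ℝ) ∈ ordIdeal κ ℝ k := by
    rw [mem_ordIdeal]
    intro m hm
    rw [map_sub, MvPolynomial.coeff_coe, coeff_truncTotal _ hm, sub_self]
  let P : F → ℝ := fun y => MvPolynomial.eval (fun i => ℓ i y) p
  have hP : ContDiff ℝ (⊤ : ℕ∞) P := contDiff_mvPolynomial_eval (fun i => (ℓ i).contDiff) p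
  have hjP : jet b' P = p := by
    rw [jet_mvPolynomial_eval b' (fun i => (ℓ i).contDiff) p]
    have e : (fun i => jet b' (ℓ i)) = (X : κ → MvPowerSeries κ ℝ) := funext hℓ
    rw [e, ← subst_coe, subst_self, id]
  have h1 := jet_comp_mem b b' hu hu0 (hh.sub hP) (k := k) (by rwa [jet_sub b' hh hP, hjP])
  have hhq : ContDiff ℝ (⊤ : ℕ∞) fun x => h (∑ i, u i x • b' i) := hh.comp hq
  have hPq' : ContDiff ℝ (⊤ : ℕ∞) fun x => P (∑ i, u i x • b' i) := hP.comp hq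
  rw [jet_sub b hhq hPq'] at h1
  have hPq : jet b (fun x => P (∑ i, u i x • b' i)) =
      subst (fun i => jet b (u i)) (p : MvPowerSeries κ ℝ) := by
    simp only [P, hℓu]
    rw [jet_mvPolynomial_eval b hu p, subst_coe]
  rw [hPq] at h1
  have h2 := subst_mem_ordIdeal hu1 hp
  rw [subst_sub hs] at h2
  have := sub_mem h1 h2
  rwa [sub_sub_sub_cancel_right] at this

end Jets

section Borel

variable {E ι : Type*} [NormedAddCommGroup E] [NormedSpace ℝ E]

theorem smooth_of_le {f : E → ℝ} (hf : ContDiff ℝ (⊤ : ℕ∞) f) (i : ℕ) : ContDiff ℝ i f :=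
  hf.of_le (by exact_mod_cast le_top)

theorem iteratedFDeriv_zero_of_homogeneous {f : E → ℝ} (hf : ContDiff ℝ (⊤ : ℕ∞) f) {k : ℕ}
    (h : ∀ (a : ℝ) (x : E), f (a • x) = a ^ k * f x) {i : ℕ} (hi : i < k) :
    iteratedFDeriv ℝ i f 0 = 0 := by
  have h1 := congrFun (iteratedFDeriv_comp_const_smul (2 : ℝ) (smooth_of_le hf i)) 0
  have h2 : (fun x => f ((2 : ℝ) • x)) = (2 ^ k : ℝ) • f := by
    funext x; rw [h]; rfl
  rw [h2, iteratedFDeriv_const_smul_apply (smooth_of_le hf i).contDiffAt] at h1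
  simp only [smul_zero] at h1
  rw [← sub_eq_zero, ← sub_smul] at h1
  refine (smul_eq_zero.1 h1).resolve_left ?_
  exact sub_ne_zero.2 (pow_lt_pow_right₀ (by norm_num) hi).ne'

theorem exists_scaling_bound {f : E → ℝ} (hf : ContDiff ℝ (⊤ : ℕ∞) f) (hc : HasCompactSupport f)
    (k : ℕ) : ∃ t : ℝ, 1 ≤ t ∧ ∀ i < k, ∀ x,
      ‖iteratedFDeriv ℝ i (fun x => (t ^ k)⁻¹ * f (t • x)) x‖ ≤ (1 / 2) ^ k := by
  have hbound : ∀ i : ℕ, ∃ R, 0 ≤ R ∧ ∀ x, ‖iteratedFDeriv ℝ i f x‖ ≤ R := by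
    intro i
    have : BddAbove (Set.range fun x => ‖iteratedFDeriv ℝ i f x‖) := by
      apply ((smooth_of_le hf i).continuous_iteratedFDeriv
        le_rfl).norm.bddAbove_range_of_hasCompactSupport
      exact HasCompactSupport.comp_left (hc.iteratedFDeriv i) norm_zero
    obtain ⟨R, hR⟩ := this
    exact ⟨R, (norm_nonneg _).trans (hR ⟨0, rfl⟩), fun x => hR ⟨x, rfl⟩⟩
  choose R hR0 hR using hbound
  set M := ∑ i ∈ Finset.range k, R i with hM
  have hM0 : 0 ≤ M := Finset.sum_nonneg fun i _ => hR0 i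
  have hRM : ∀ i < k, R i ≤ M := fun i hi =>
    Finset.single_le_sum (fun i _ => hR0 i) (Finset.mem_range.2 hi)
  have ht1 : (1 : ℝ) ≤ 1 + 2 ^ k * M := by
    have : (0 : ℝ) ≤ 2 ^ k * M := by positivity
    linarith
  refine ⟨1 + 2 ^ k * M, ht1, fun i hi x => ?_⟩
  set t : ℝ := 1 + 2 ^ k * M with ht
  have ht0 : 0 < t := by linarith
  have hcomp : ContDiff ℝ i fun x => f (t • x) :=
    (smooth_of_le hf i).comp (contDiff_const_smul t)
  have e : (fun x => (t ^ k)⁻¹ * f (t • x)) = (t ^ k)⁻¹ • fun x => f (t • x) := rfl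
  rw [e, iteratedFDeriv_const_smul_apply hcomp.contDiffAt,
    iteratedFDeriv_comp_const_smul t (smooth_of_le hf i), norm_smul, norm_smul, norm_inv, norm_pow,
    norm_pow, Real.norm_of_nonneg ht0.le]
  have h1 : (t ^ k)⁻¹ * t ^ i ≤ t⁻¹ := by
    obtain ⟨j, rfl⟩ : ∃ j, k = i + j + 1 := ⟨k - i - 1, by omega⟩
    rw [pow_succ, pow_add]
    have : (1 : ℝ) ≤ t ^ j := one_le_pow₀ ht1
    have hp : 0 < t ^ i := by positivity
    field_simp
    exact this
  calc (t ^ k)⁻¹ * (t ^ i * ‖iteratedFDeriv ℝ i f (t • x)‖)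
      = ((t ^ k)⁻¹ * t ^ i) * ‖iteratedFDeriv ℝ i f (t • x)‖ := by ring
    _ ≤ t⁻¹ * M := by
        gcongr
        exact (hR i _).trans (hRM i hi)
    _ ≤ (1 / 2) ^ k := by
        rw [inv_mul_le_iff₀ ht0, ht, one_div, inv_pow]
        have : (0 : ℝ) < 2 ^ k := by positivity
        rw [le_mul_inv_iff₀ this]
        linarith

variable [Fintype ι]

theorem jet_congr (b : ι → E) {f g : E → ℝ} (h : f =ᶠ[nhds 0] g) : jet b f = jet b g := by
  funext m
  simp only [jet]
  rw [(h.iteratedFDeriv ℝ _).eq_of_nhds]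

theorem jet_mem_ordIdeal (b : ι → E) {f : E → ℝ} {k : ℕ}
    (h : ∀ i < k, iteratedFDeriv ℝ i f 0 = 0) : jet b f ∈ ordIdeal ι ℝ k := by
  rw [mem_ordIdeal]
  intro m hm
  change _ * iteratedFDeriv ℝ _ f 0 _ = 0
  rw [h, _root_.zero_apply, mul_zero]
  rw [Multiset.length_toList, Finsupp.card_toMultiset]
  exact hm

/-- The homogeneous polynomial of degree `k` in a power series. -/
def homogPoly (H : MvPowerSeries ι ℝ) (k : ℕ) : MvPolynomial ι ℝ :=
  truncTotal (k + 1) H - truncTotal k H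

theorem eval_homogPoly_smul (H : MvPowerSeries ι ℝ) (k : ℕ) (a : ℝ) (y : ι → ℝ) :
    MvPolynomial.eval (fun i => a * y i) (homogPoly H k) =
      a ^ k * MvPolynomial.eval y (homogPoly H k) := by
  rw [MvPolynomial.eval_eq, MvPolynomial.eval_eq, Finset.mul_sum]
  refine Finset.sum_congr rfl fun m hm => ?_
  have hk : m.degree = k := by
    rw [MvPolynomial.mem_support_iff, homogPoly, MvPolynomial.coeff_sub, coeff_truncTotal_eq_ite,
      coeff_truncTotal_eq_ite] at hm
    by_contra hne
    apply hm
    by_cases h : m.degree < k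
    · rw [if_pos (by omega), if_pos h, sub_self]
    · rw [if_neg (by omega), if_neg h, sub_self]
  simp only [mul_pow, Finset.prod_mul_distrib, Finset.prod_pow_eq_pow_sum]
  rw [← Finsupp.degree_apply, hk]
  ring

theorem sum_homogPoly (H : MvPowerSeries ι ℝ) (K : ℕ) :
    ∑ k ∈ Finset.range K, (homogPoly H k : MvPowerSeries ι ℝ) =
      (truncTotal K H : MvPolynomial ι ℝ) := by
  have h : ∀ k, (homogPoly H k : MvPowerSeries ι ℝ) =
      (truncTotal (k + 1) H : MvPolynomial ι ℝ) - (truncTotal k H : MvPolynomial ι ℝ) := fun k => by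
    ext m
    simp [homogPoly]
  have h0 : ((truncTotal 0 H : MvPolynomial ι ℝ) : MvPowerSeries ι ℝ) = 0 := by
    ext m
    rw [MvPolynomial.coeff_coe, coeff_truncTotal_eq_zero _ (Nat.zero_le _), map_zero]
  simp only [h]
  rw [Finset.sum_range_sub (fun k => ((truncTotal k H : MvPolynomial ι ℝ) : MvPowerSeries ι ℝ)),
    h0, sub_zero]

/-- **Borel's lemma**: every formal power series is the Taylor series of a smooth function. -/
theorem exists_contDiff_jet_eq [FiniteDimensional ℝ E] (b : ι → E) {ℓ : ι → E →L[ℝ] ℝ} (hℓ : ∀ i, jet b (ℓ i) = X i)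
    (H : MvPowerSeries ι ℝ) :
    ∃ h : E → ℝ, ContDiff ℝ (⊤ : ℕ∞) h ∧ jet b h = H := by
  let χ : ContDiffBump (0 : E) := ⟨1, 2, one_pos, one_lt_two⟩
  let P : ℕ → E → ℝ := fun k x => MvPolynomial.eval (fun i => ℓ i x) (homogPoly H k)
  have hP : ∀ k, ContDiff ℝ (⊤ : ℕ∞) (P k) := fun k =>
    contDiff_mvPolynomial_eval (fun i => (ℓ i).contDiff) _
  have hPs : ∀ k (a : ℝ) x, P k (a • x) = a ^ k * P k x := fun k a x => by
    simp only [P, map_smul, smul_eq_mul]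
    exact eval_homogPoly_smul H k a _
  have hG : ∀ k, ContDiff ℝ (⊤ : ℕ∞) fun x => χ x * P k x := fun k => χ.contDiff.mul (hP k)
  have hGc : ∀ k, HasCompactSupport fun x => χ x * P k x := fun k =>
    χ.hasCompactSupport.mul_right
  choose t ht1 ht using fun k => exists_scaling_bound (hG k) (hGc k) k
  let g : ℕ → E → ℝ := fun k x => (t k ^ k)⁻¹ * (χ (t k • x) * P k (t k • x))
  have hg : ∀ k, ContDiff ℝ (⊤ : ℕ∞) (g k) := fun k =>
    contDiff_const.mul ((hG k).comp (contDiff_const_smul (t k)))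
  have hgP : ∀ k, g k =ᶠ[nhds 0] P k := by
    intro k
    have h0 : Filter.Tendsto (fun x : E => t k • x) (nhds 0) (nhds 0) := by
      have : Continuous fun x : E => t k • x := continuous_const_smul (t k)
      simpa using this.tendsto 0
    filter_upwards [h0.eventually χ.eventuallyEq_one] with x hx
    simp only [g]
    rw [hx, Pi.one_apply, one_mul, hPs, ← mul_assoc, inv_mul_cancel₀, one_mul]
    have := ht1 k
    positivity
  have hsum : Summable fun k : ℕ => ((1 : ℝ) / 2) ^ k := summable_geometric_two
  have hgs : ∀ x, Summable fun k => g k x := fun x => by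
    refine Summable.of_norm_bounded_eventually hsum ?_
    rw [Nat.cofinite_eq_atTop]
    filter_upwards [Filter.eventually_gt_atTop 0] with k hk
    have := ht k 0 hk x
    rwa [norm_iteratedFDeriv_zero] at this
  refine ⟨fun x => ∑' k, g k x, ?_, ?_⟩
  · refine contDiff_tsum_of_eventually (v := fun _ k => (1 / 2) ^ k) hg (fun _ _ => hsum) ?_
    intro i _
    rw [Nat.cofinite_eq_atTop]
    filter_upwards [Filter.eventually_gt_atTop i] with k hk x
    exact ht k i hk x
  · rw [← sub_eq_zero]
    refine eq_zero_of_forall_mem_ordIdeal fun K => ?_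
    have hsumK : Summable fun k : ℕ => ((1 : ℝ) / 2) ^ (k + K) :=
      (summable_nat_add_iff K).2 hsum
    have htail : ContDiff ℝ (⊤ : ℕ∞) fun x => ∑' k, g (k + K) x := by
      refine contDiff_tsum_of_eventually (v := fun _ k => (1 / 2) ^ (k + K)) (fun k => hg _)
        (fun _ _ => hsumK) ?_
      intro i _
      rw [Nat.cofinite_eq_atTop]
      filter_upwards [Filter.eventually_gt_atTop i] with k hk x
      exact ht (k + K) i (by omega) x
    have htail0 : jet b (fun x => ∑' k, g (k + K) x) ∈ ordIdeal ι ℝ K := by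
      refine jet_mem_ordIdeal b fun i hi => ?_
      have := iteratedFDeriv_tsum_apply (𝕜 := ℝ) (N := (i : ℕ∞)) (f := fun k => g (k + K))
        (v := fun _ k => (1 / 2) ^ (k + K)) (fun k => smooth_of_le (hg _) i) (fun _ _ => hsumK)
        (fun j k x hj => ht (k + K) j (by
          have : j ≤ i := by exact_mod_cast hj
          omega) x) le_rfl 0
      rw [this]
      have hz : ∀ k, iteratedFDeriv ℝ i (g (k + K)) 0 = 0 := fun k => by
        rw [((hgP (k + K)).iteratedFDeriv ℝ i).eq_of_nhds]
        exact iteratedFDeriv_zero_of_homogeneous (hP _) (hPs _) (by omega)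
      simp only [hz, tsum_zero]
    have hsplit : (fun x => ∑' k, g k x) =
        fun x => ∑ k ∈ Finset.range K, g k x + ∑' k, g (k + K) x :=
      funext fun x => ((hgs x).sum_add_tsum_nat_add K).symm
    have hjg : ∀ k, jet b (g k) = (homogPoly H k : MvPowerSeries ι ℝ) := fun k => by
      rw [jet_congr b (hgP k), jet_mvPolynomial_eval b (fun i => (ℓ i).contDiff),
        show (fun i => jet b (ℓ i)) = (X : ι → MvPowerSeries ι ℝ) from funext hℓ, ← subst_coe,
        subst_self, id]
    have hfin : ∑ k ∈ Finset.range K, jet b (g k) = (truncTotal K H : MvPolynomial ι ℝ) := by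
      simp only [hjg]
      exact sum_homogPoly H K
    rw [hsplit, jet_add b (ContDiff.sum fun k _ => hg k) htail, jet_sum b _ hg, hfin,
      add_sub_right_comm]
    refine add_mem ?_ htail0
    rw [mem_ordIdeal]
    intro m hm
    rw [map_sub, MvPolynomial.coeff_coe, coeff_truncTotal _ hm, sub_self]

end Borel

section PhaseSpace

variable {n : ℕ}

/-- The real coordinates as continuous linear functionals. -/
def coordL : Coord n → Phase n →L[ℝ] ℝ
  | .inl i => if i = 0 then (ContinuousLinearMap.fst ℝ ℝ ℝ).comp (ContinuousLinearMap.fst ℝ _ _)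
      else (ContinuousLinearMap.snd ℝ ℝ ℝ).comp (ContinuousLinearMap.fst ℝ _ _)
  | .inr (.inl j) => Complex.reCLM.comp
      ((ContinuousLinearMap.proj j).comp (ContinuousLinearMap.snd ℝ _ _))
  | .inr (.inr j) => Complex.imCLM.comp
      ((ContinuousLinearMap.proj j).comp (ContinuousLinearMap.snd ℝ _ _))

theorem coordL_apply (c : Coord n) (p : Phase n) : coordL c p = coord c p := by
  rcases c with i | j | j
  · by_cases h : i = 0 <;> simp [coordL, coord, h]
  · rfl
  · rfl

theorem coe_coordL (c : Coord n) : ⇑(coordL c) = coord c := funext (coordL_apply c)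

theorem contDiff_coord (c : Coord n) : ContDiff ℝ (⊤ : ℕ∞) (coord c : Phase n → ℝ) := by
  rw [← coe_coordL]; exact (coordL c).contDiff

theorem jet_coord (c : Coord n) : jet unitVec (coord c : Phase n → ℝ) = X c := by
  rw [← coe_coordL, jet_clm, Finset.sum_eq_single c]
  · rw [coordL_apply, coord_unitVec, if_pos rfl, map_one, one_mul]
  · intro d _ hd
    rw [coordL_apply, coord_unitVec, if_neg hd.symm, map_zero, zero_mul]
  · simp

theorem phase_ext {p q : Phase n} (h : ∀ c, coord c p = coord c q) : p = q := by
  refine Prod.ext (Prod.ext ?_ ?_) (funext fun j => Complex.ext ?_ ?_)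
  · simpa [coord] using h (.inl 0)
  · simpa [coord] using h (.inl 1)
  · exact h (.inr (.inl j))
  · exact h (.inr (.inr j))

theorem coord_sum_smul_unitVec (u : Coord n → ℝ) (c : Coord n) :
    coord c (∑ d, u d • unitVec d) = u c := by
  rw [← coordL_apply, map_sum, Finset.sum_eq_single c]
  · rw [map_smul, coordL_apply, coord_unitVec, if_pos rfl, smul_eq_mul, mul_one]
  · intro d _ hd
    rw [map_smul, coordL_apply, coord_unitVec, if_neg hd.symm, smul_zero]
  · simp

theorem contDiff_coord_comp {Y : Phase n → Phase n} (hY : ContDiff ℝ (⊤ : ℕ∞) Y) (c : Coord n) :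
    ContDiff ℝ (⊤ : ℕ∞) fun p => coord c (Y p) :=
  (contDiff_coord c).comp hY

/-- The linear vector field as a continuous linear map. -/
def linearFieldL (ω : Fin n → ℝ) : Phase n →L[ℝ] Phase n :=
  LinearMap.toContinuousLinearMap
    { toFun := linearField ω
      map_add' := fun p q => by
        refine Prod.ext (Prod.ext rfl ?_) (funext fun j => ?_)
        · simp [linearField]
        · simp [linearField]; ring
      map_smul' := fun a p => by
        refine Prod.ext (Prod.ext rfl ?_) (funext fun j => ?_)
        · simp [linearField]
        · simp [linearField]; ring }

theorem linearFieldL_apply (ω : Fin n → ℝ) (p : Phase n) :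
    linearFieldL ω p = linearField ω p := rfl

theorem contDiff_linearField (ω : Fin n → ℝ) :
    ContDiff ℝ (⊤ : ℕ∞) (linearField ω : Phase n → Phase n) := (linearFieldL ω).contDiff

theorem formalField_linearField (ω : Fin n → ℝ) (c : Coord n) :
    formalField (linearField ω) c = lin ω c := by
  rw [formalField, taylorSeries_eq_jet]
  rcases c with i | j | j
  · by_cases hi : i = 0
    · have : (fun p : Phase n => coord (.inl i) (linearField ω p)) = coord (.inl 1) := by
        funext p; simp [coord, linearField, hi]
      rw [this, jet_coord]
      simp [lin, linAct, hi]
    · have : (fun p : Phase n => coord (.inl i) (linearField ω p)) = fun _ => 0 := by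
        funext p; simp [coord, linearField, hi]
      rw [this, jet_const]
      simp [lin, linAct, hi]
  · have : (fun p : Phase n => coord (.inr (.inl j)) (linearField ω p)) =
        fun p => ω j * coord (.inr (.inr j)) p := by
      funext p; simp [coord, linearField]
    rw [this, jet_smul _ _ (contDiff_coord _), jet_coord]
    rfl
  · have : (fun p : Phase n => coord (.inr (.inr j)) (linearField ω p)) =
        fun p => -(ω j * coord (.inr (.inl j)) p) := by
      funext p; simp [coord, linearField]
    rw [this, jet_neg _ (contDiff_const.mul (contDiff_coord _)), jet_smul _ _ (contDiff_coord _),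
      jet_coord]
    rfl

theorem constantCoeff_formalField {Y : Phase n → Phase n} (hY : ContDiff ℝ (⊤ : ℕ∞) Y)
    (c : Coord n) : constantCoeff (formalField Y c) = coord c (Y 0) := by
  rw [formalField, taylorSeries_eq_jet, constantCoeff_jet _ (contDiff_coord_comp hY c)]

theorem constantCoeff_pderiv_formalField {Y : Phase n → Phase n} (hY : ContDiff ℝ (⊤ : ℕ∞) Y)
    (c d : Coord n) :
    constantCoeff (pderiv ℝ d (formalField Y c)) = coord c (fderiv ℝ Y 0 (unitVec d)) := by
  have hc := contDiff_coord_comp hY c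
  rw [formalField, taylorSeries_eq_jet, pderiv_jet _ hc, constantCoeff_jet _ (contDiff_dirD _ hc)]
  have := ((coordL c).hasFDerivAt.comp (0 : Phase n)
    (smooth_differentiableAt hY 0).hasFDerivAt).fderiv
  rw [coe_coordL] at this
  change fderiv ℝ (coord c ∘ Y) 0 (unitVec d) = _
  rw [this, ← coordL_apply]
  rfl

theorem constantCoeff_lin (ω : Fin n → ℝ) (c : Coord n) :
    constantCoeff (lin ω c : RSer n) = 0 :=
  mem_ordIdeal_one.1 (homog_le_ordIdeal (lin_mem_homog ω c))

theorem constantCoeff_pderiv_lin (ω : Fin n → ℝ) (c d : Coord n) :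
    constantCoeff (pderiv ℝ d (lin ω c)) = coord c (linearField ω (unitVec d)) := by
  have h : fderiv ℝ (linearField ω) 0 = linearFieldL ω := (linearFieldL ω).fderiv
  rw [← formalField_linearField, constantCoeff_pderiv_formalField (contDiff_linearField ω), h,
    linearFieldL_apply]

/-- A smooth vector field vanishes at the origin with linear part `linearField ω` if and only if
its formal field agrees with `lin ω` up to terms of degree two. -/
theorem formalField_sub_lin_mem_iff {ω : Fin n → ℝ} {Y : Phase n → Phase n}
    (hY : ContDiff ℝ (⊤ : ℕ∞) Y) :
    (∀ c, formalField Y c - lin ω c ∈ ordIdeal (Coord n) ℝ 2) ↔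
      Y 0 = 0 ∧ ∀ p, fderiv ℝ Y 0 p = linearField ω p := by
  constructor
  · intro h
    constructor
    · refine phase_ext fun c => ?_
      have := mem_ordIdeal_one.1 (ordIdeal_anti (by omega : 1 ≤ 2) (h c))
      rw [map_sub, constantCoeff_formalField hY, constantCoeff_lin, sub_zero] at this
      rw [this, ← coordL_apply, map_zero]
    · have hd : ∀ d, fderiv ℝ Y 0 (unitVec d) = linearField ω (unitVec d) := fun d => by
        refine phase_ext fun c => ?_
        have := mem_ordIdeal_one.1 (pderiv_mem_ordIdeal (h c) d)
        rw [map_sub, map_sub, constantCoeff_pderiv_formalField hY, constantCoeff_pderiv_lin,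
          sub_eq_zero] at this
        exact this
      intro p
      have hp : p = ∑ d, coord d p • unitVec d :=
        phase_ext fun c => (coord_sum_smul_unitVec (fun d => coord d p) c).symm
      rw [hp, ← linearFieldL_apply, map_sum, map_sum]
      refine Finset.sum_congr rfl fun d _ => ?_
      rw [map_smul, map_smul, hd, linearFieldL_apply]
  · rintro ⟨h0, h1⟩ c
    refine mem_ordIdeal_succ ?_ fun d => mem_ordIdeal_one.2 ?_
    · rw [map_sub, constantCoeff_formalField hY, h0, constantCoeff_lin, ← coordL_apply, map_zero,
        sub_zero]
    · rw [map_sub, map_sub, constantCoeff_pderiv_formalField hY, constantCoeff_pderiv_lin, h1,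
        sub_self]

theorem coord_psi (a₀ : ℝ) (a : Fin n → ℝ) (c : Coord n) (p : Phase n) :
    coord c (psi a₀ a p) = sgn a₀ a c * coord c p := by
  rcases c with i | j | j
  · by_cases h : i = 0 <;> simp [coord, psi, sgn, h]
  · simp [coord, psi, sgn]
  · simp [coord, psi, sgn]

theorem phi_eq_psi : (phi : Phase n → Phase n) = psi 1 1 := by
  funext p
  simp [phi, psi]

theorem signSymm_formalField {a₀ : ℝ} {a : Fin n → ℝ} {Y : Phase n → Phase n}
    (hY : ContDiff ℝ (⊤ : ℕ∞) Y) (h : ∀ p, Y (psi a₀ a p) = -psi a₀ a (Y p)) :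
    SignSymm (sgn a₀ a) (-1) (formalField Y) := by
  intro c
  have hc := contDiff_coord_comp hY c
  have hu : ∀ d, ContDiff ℝ (⊤ : ℕ∞) fun p : Phase n => sgn a₀ a d * coord d p :=
    fun d => contDiff_const.mul (contDiff_coord d)
  have h1 := jet_comp (ι := Coord n) (unitVec : Coord n → Phase n) unitVec (ℓ := coordL)
    (fun d => by rw [coe_coordL, jet_coord]) hu
    (fun d => by rw [← coordL_apply, map_zero, mul_zero])
    (fun d p => by rw [coordL_apply, coord_sum_smul_unitVec]) hc
  have h2 : (fun p : Phase n => coord c (Y (∑ d, (sgn a₀ a d * coord d p) • unitVec d))) =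
      fun p => (-1 * sgn a₀ a c) * coord c (Y p) := by
    funext p
    have : ∑ d, (sgn a₀ a d * coord d p) • unitVec d = psi a₀ a p :=
      phase_ext fun c => by rw [coord_sum_smul_unitVec, coord_psi]
    rw [this, h, ← coordL_apply, map_neg, coordL_apply, coord_psi]
    ring
  rw [h2, jet_smul _ _ hc] at h1
  have h3 : (fun d => jet unitVec fun p : Phase n => sgn a₀ a d * coord d p) =
      (sgn a₀ a • X : Coord n → RSer n) := by
    funext d
    rw [jet_smul _ _ (contDiff_coord d), jet_coord, Pi.smul_apply', smul_eq_C_mul]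
  rw [h3, ← rescale_eq_subst] at h1
  exact h1.symm

end PhaseSpace

section Assembly

variable {n : ℕ}

/-- The basis of the space of invariants. -/
def invVec : Option (Fin n) → ℝ × (Fin n → ℝ)
  | none => (1, 0)
  | some j => (0, Pi.single j 1)

/-- The coordinates on the space of invariants. -/
def invCoord : Option (Fin n) → (ℝ × (Fin n → ℝ)) →L[ℝ] ℝ
  | none => ContinuousLinearMap.fst ℝ _ _
  | some j => (ContinuousLinearMap.proj j).comp (ContinuousLinearMap.snd ℝ _ _)

theorem invCoord_invVec (i j : Option (Fin n)) :
    invCoord i (invVec j) = if i = j then 1 else 0 := by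
  cases i <;> cases j <;> simp [invCoord, invVec, Pi.single_apply]

theorem jet_invCoord (i : Option (Fin n)) : jet invVec (invCoord i) = X i := by
  rw [jet_clm, Finset.sum_eq_single i]
  · rw [invCoord_invVec, if_pos rfl, map_one, one_mul]
  · intro d _ hd
    rw [invCoord_invVec, if_neg hd.symm, map_zero, zero_mul]
  · simp

/-- The invariants as functions on the phase space. -/
def invFun (δ : ℕ) : Option (Fin n) → Phase n → ℝ
  | none, p => coord (.inl 0) p ^ (1 + δ)
  | some j, p => coord (.inr (.inl j)) p ^ 2 + coord (.inr (.inr j)) p ^ 2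

theorem contDiff_invFun (δ : ℕ) (i : Option (Fin n)) : ContDiff ℝ (⊤ : ℕ∞) (invFun δ i) := by
  cases i with
  | none => exact (contDiff_coord _).pow _
  | some j => exact ((contDiff_coord _).pow 2).add ((contDiff_coord _).pow 2)

theorem jet_invFun (δ : ℕ) (i : Option (Fin n)) : jet unitVec (invFun δ i) = invs δ i := by
  cases i with
  | none =>
    change jet unitVec (fun p => coord (.inl 0) p ^ (1 + δ)) = _
    rw [jet_pow _ (contDiff_coord _), jet_coord]
    rfl
  | some j =>
    change jet unitVec (fun p => coord (.inr (.inl j)) p ^ 2 + coord (.inr (.inr j)) p ^ 2) = _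
    rw [jet_add _ ((contDiff_coord _).pow 2) ((contDiff_coord _).pow 2),
      jet_pow _ (contDiff_coord _), jet_pow _ (contDiff_coord _), jet_coord, jet_coord]
    rfl

theorem sum_invFun_smul (δ : ℕ) (p : Phase n) :
    ∑ i, invFun δ i p • invVec i = (p.1.1 ^ (1 + δ), fun k => ‖p.2 k‖ ^ 2) := by
  rw [Fintype.sum_option]
  refine Prod.ext ?_ (funext fun k => ?_)
  · simp [invFun, invVec, coord, Prod.fst_sum]
  · simp [invFun, invVec, coord, Prod.snd_sum, Finset.sum_apply, Pi.single_apply]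
    rw [Complex.sq_norm, Complex.normSq_apply, pow_two, pow_two]

/-- The common shape of the two normal forms. -/
def normalForm (δ : ℕ) (ω : Fin n → ℝ) (f : Option (Fin n) → ℝ × (Fin n → ℝ) → ℝ) (p : Phase n) :
    Phase n :=
  ((p.1.2, p.1.1 ^ δ * f none (p.1.1 ^ (1 + δ), fun k => ‖p.2 k‖ ^ 2)),
    fun j => -Complex.I * (ω j : ℂ) * p.2 j
      + Complex.I * p.2 j * (f (some j) (p.1.1 ^ (1 + δ), fun k => ‖p.2 k‖ ^ 2) : ℂ))

theorem normalForm_zero (ω : Fin n → ℝ) (f : Option (Fin n) → ℝ × (Fin n → ℝ) → ℝ) :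
    normalForm 0 ω f = normalFormPos ω (f none) fun j => f (some j) := by
  funext p
  simp [normalForm, normalFormPos]

theorem normalForm_one (ω : Fin n → ℝ) (f : Option (Fin n) → ℝ × (Fin n → ℝ) → ℝ) :
    normalForm 1 ω f = normalFormNeg ω (f none) fun j => f (some j) := by
  funext p
  simp [normalForm, normalFormNeg]

variable {δ : ℕ} {ω : Fin n → ℝ} {f : Option (Fin n) → ℝ × (Fin n → ℝ) → ℝ}

theorem contDiff_invariants (δ : ℕ) :
    ContDiff ℝ (⊤ : ℕ∞) fun p : Phase n => (p.1.1 ^ (1 + δ), fun k => ‖p.2 k‖ ^ 2) := by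
  have : (fun p : Phase n => (p.1.1 ^ (1 + δ), fun k => ‖p.2 k‖ ^ 2)) =
      fun p => ∑ i, invFun δ i p • invVec i := funext fun p => (sum_invFun_smul δ p).symm
  rw [this]
  exact ContDiff.sum fun i _ => (contDiff_invFun δ i).smul contDiff_const

theorem contDiff_normalForm (hf : ∀ i, ContDiff ℝ (⊤ : ℕ∞) (f i)) :
    ContDiff ℝ (⊤ : ℕ∞) (normalForm δ ω f) := by
  have hc : ∀ i, ContDiff ℝ (⊤ : ℕ∞)
      fun p : Phase n => f i (p.1.1 ^ (1 + δ), fun k => ‖p.2 k‖ ^ 2) :=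
    fun i => (hf i).comp (contDiff_invariants δ)
  have hz : ∀ j, ContDiff ℝ (⊤ : ℕ∞) fun p : Phase n => p.2 j := fun j =>
    ((ContinuousLinearMap.proj j : (Fin n → ℂ) →L[ℝ] ℂ).comp
      (ContinuousLinearMap.snd ℝ (ℝ × ℝ) (Fin n → ℂ))).contDiff
  refine (contDiff_fst.snd.prodMk ((contDiff_fst.fst.pow δ).mul (hc none))).prodMk
    (contDiff_pi.2 fun j => ?_)
  exact (contDiff_const.mul (hz j)).add
    ((contDiff_const.mul (hz j)).mul (Complex.ofRealCLM.contDiff.comp (hc (some j))))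

theorem jet_comp_invariants (hf : ∀ i, ContDiff ℝ (⊤ : ℕ∞) (f i))
    (i : Option (Fin n)) :
    jet unitVec (fun p : Phase n => f i (p.1.1 ^ (1 + δ), fun k => ‖p.2 k‖ ^ 2)) =
      subst (invs δ) (jet invVec (f i)) := by
  have h0 : ∀ i : Option (Fin n), invFun δ i (0 : Phase n) = 0 := by
    intro i
    cases i <;> simp [invFun, coord]
  have h := jet_comp (unitVec : Coord n → Phase n) invVec (ℓ := invCoord) jet_invCoord
    (contDiff_invFun δ) h0 (fun i p => by
      rw [map_sum, Finset.sum_eq_single i]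
      · rw [map_smul, invCoord_invVec, if_pos rfl, smul_eq_mul, mul_one]
      · intro d _ hd
        rw [map_smul, invCoord_invVec, if_neg hd.symm, smul_zero]
      · simp) (hf i)
  simp only [sum_invFun_smul, jet_invFun] at h
  exact h

theorem formalField_normalForm (hf : ∀ i, ContDiff ℝ (⊤ : ℕ∞) (f i))
    (c : Coord n) :
    formalField (normalForm δ ω f) c = lin ω c + nfField δ (fun i => jet invVec (f i)) c := by
  have hc : ∀ i, ContDiff ℝ (⊤ : ℕ∞)
      fun p : Phase n => f i (p.1.1 ^ (1 + δ), fun k => ‖p.2 k‖ ^ 2) :=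
    fun i => (hf i).comp (contDiff_invariants δ)
  rw [formalField, taylorSeries_eq_jet]
  rcases c with i | j | j
  · by_cases hi : i = 0
    · have : (fun p : Phase n => coord (.inl i) (normalForm δ ω f p)) = coord (.inl 1) := by
        funext p; simp [coord, normalForm, hi]
      rw [this, jet_coord]
      simp [lin, linAct, nfField, hi]
    · have : (fun p : Phase n => coord (.inl i) (normalForm δ ω f p)) =
          fun p => coord (.inl 0) p ^ δ * f none (p.1.1 ^ (1 + δ), fun k => ‖p.2 k‖ ^ 2) := by
        funext p; simp [coord, normalForm, hi]
      rw [this, jet_mul _ ((contDiff_coord _).pow δ) (hc none), jet_pow _ (contDiff_coord _),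
        jet_coord, jet_comp_invariants hf]
      simp [lin, linAct, nfField, hi]
  · have : (fun p : Phase n => coord (.inr (.inl j)) (normalForm δ ω f p)) =
        fun p => ω j * coord (.inr (.inr j)) p -
          coord (.inr (.inr j)) p * f (some j) (p.1.1 ^ (1 + δ), fun k => ‖p.2 k‖ ^ 2) := by
      funext p; simp [coord, normalForm]; ring
    rw [this, jet_sub _ (contDiff_const.mul (contDiff_coord _)) ((contDiff_coord _).mul (hc _)),
      jet_smul _ _ (contDiff_coord _), jet_mul _ (contDiff_coord _) (hc _), jet_coord,
      jet_comp_invariants hf]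
    simp [lin, linAct, nfField, sub_eq_add_neg]
  · have : (fun p : Phase n => coord (.inr (.inr j)) (normalForm δ ω f p)) =
        fun p => coord (.inr (.inl j)) p * f (some j) (p.1.1 ^ (1 + δ), fun k => ‖p.2 k‖ ^ 2) -
          ω j * coord (.inr (.inl j)) p := by
      funext p; simp [coord, normalForm]; ring
    rw [this, jet_sub _ ((contDiff_coord _).mul (hc _)) (contDiff_const.mul (contDiff_coord _)),
      jet_smul _ _ (contDiff_coord _), jet_mul _ (contDiff_coord _) (hc _), jet_coord,
      jet_comp_invariants hf]
    simp [lin, linAct, nfField, sub_eq_add_neg, add_comm]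

theorem normalForm_psi {a₀ : ℝ} {a : Fin n → ℝ} (h₁ : a₀ ^ (1 + δ) = 1) (h₂ : a₀ ^ δ = a₀)
    (ha : ∀ j, a j * a j = 1) (p : Phase n) :
    normalForm δ ω f (psi a₀ a p) = -psi a₀ a (normalForm δ ω f p) := by
  have hI : (((psi a₀ a p).1.1 ^ (1 + δ), fun k => ‖(psi a₀ a p).2 k‖ ^ 2) : ℝ × (Fin n → ℝ)) =
      (p.1.1 ^ (1 + δ), fun k => ‖p.2 k‖ ^ 2) := by
    refine Prod.ext ?_ (funext fun k => ?_)
    · simp [psi, mul_pow, h₁]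
    · have : |a k| ^ 2 = 1 := by rw [sq_abs, pow_two, ha]
      simp [psi, mul_pow, this]
  simp only [normalForm, hI]
  refine Prod.ext (Prod.ext ?_ ?_) (funext fun j => ?_)
  · simp [psi]
  · simp [psi, mul_pow, h₂, mul_assoc]
  · simp [psi]
    ring

/-- Both normal forms at once, `δ = 0` for `a₀ = 1` and `δ = 1` for `a₀ = -1`. -/
theorem exists_normalForm (hω : LinearIndependent ℚ ω) (hδ : δ = 0 ∨ δ = 1) {a : Fin n → ℝ}
    (ha : ∀ j, a j * a j = 1) {V : Phase n → Phase n}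
    (hV : IsBireversibleSystem ω ((-1) ^ δ) a V) :
    ∃ f : Option (Fin n) → ℝ × (Fin n → ℝ) → ℝ, (∀ i, ContDiff ℝ (⊤ : ℕ∞) (f i)) ∧
      IsBireversibleSystem ω ((-1) ^ δ) a (normalForm δ ω f) ∧
      FormallyConjugate V (normalForm δ ω f) := by
  have hlin := (formalField_sub_lin_mem_iff hV.smooth).2 ⟨hV.equilibrium, hV.linear_part⟩
  have hφ := signSymm_formalField (a₀ := 1) (a := 1) hV.smooth (by
    rw [← phi_eq_psi]; exact hV.reversible_phi)
  obtain ⟨Φ, H, hΦ, hH, hconj⟩ := exists_formal_normal_form hω ha hδ hlin hφ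
    (signSymm_formalField hV.smooth hV.reversible_psi)
  choose f hf hfH using fun i => exists_contDiff_jet_eq invVec jet_invCoord (H i)
  have hY := contDiff_normalForm (δ := δ) (ω := ω) hf
  have hYf : ∀ c, formalField (normalForm δ ω f) c = lin ω c + nfField δ H c := fun c => by
    rw [formalField_normalForm hf, show (fun i => jet invVec (f i)) = H from funext hfH]
  have hYlin := (formalField_sub_lin_mem_iff (ω := ω) hY).1 fun c => by
    rw [hYf, add_sub_cancel_left]
    exact hH.nfField_mem c
  refine ⟨f, hf, ⟨hY, hYlin.1, hYlin.2, ?_, ?_⟩, Φ, ⟨fun c => ?_, fun c d => ?_⟩, fun c => ?_⟩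
  · rw [phi_eq_psi]
    exact normalForm_psi (one_pow _) (one_pow _) (by simp)
  · refine normalForm_psi ?_ ?_ ha
    · rcases hδ with rfl | rfl <;> norm_num
    · rcases hδ with rfl | rfl <;> norm_num
  · exact mem_ordIdeal_one.1 (mem_ordIdeal_one_of_sub_X (hΦ c))
  · have := mem_ordIdeal.1 (hΦ c) (Finsupp.single d 1) (by simp)
    rw [map_sub, sub_eq_zero] at this
    rw [this, coeff_X]
    simp [Finsupp.single_left_inj, eq_comm]
  · rw [hYf, hconj]

end Assembly

end Bireversible
end

theorem mainTheorem3 (n : ℕ) (ω : Fin n → ℝ) (hω : LinearIndependent ℚ ω)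
    (a₀ : ℝ) (a : Fin n → ℝ) (ha : ∀ j, a j = 1 ∨ a j = -1)
    (X : Bireversible.Phase n → Bireversible.Phase n)
    (hX : Bireversible.IsBireversibleSystem ω a₀ a X) :
    (a₀ = 1 → ∃ (f₀ : ℝ × (Fin n → ℝ) → ℝ) (f : Fin n → ℝ × (Fin n → ℝ) → ℝ),
      ContDiff ℝ (⊤ : ℕ∞) f₀ ∧ (∀ j, ContDiff ℝ (⊤ : ℕ∞) (f j)) ∧
      Bireversible.IsBireversibleSystem ω a₀ a (Bireversible.normalFormPos ω f₀ f) ∧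
      Bireversible.FormallyConjugate X (Bireversible.normalFormPos ω f₀ f)) ∧
    (a₀ = -1 → ∃ (f₀ : ℝ × (Fin n → ℝ) → ℝ) (f : Fin n → ℝ × (Fin n → ℝ) → ℝ),
      ContDiff ℝ (⊤ : ℕ∞) f₀ ∧ (∀ j, ContDiff ℝ (⊤ : ℕ∞) (f j)) ∧
      Bireversible.IsBireversibleSystem ω a₀ a (Bireversible.normalFormNeg ω f₀ f) ∧
      Bireversible.FormallyConjugate X (Bireversible.normalFormNeg ω f₀ f)) := by
  have ha' : ∀ j, a j * a j = 1 := fun j => by rcases ha j with h | h <;> rw [h] <;> norm_num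
  constructor
  · rintro rfl
    obtain ⟨f, hf, h1, h2⟩ := Bireversible.exists_normalForm hω (δ := 0) (Or.inl rfl) ha'
      (by rwa [pow_zero])
    rw [Bireversible.normalForm_zero] at h1 h2
    rw [pow_zero] at h1
    exact ⟨f none, fun j => f (some j), hf none, fun j => hf (some j), h1, h2⟩
  · rintro rfl
    obtain ⟨f, hf, h1, h2⟩ := Bireversible.exists_normalForm hω (δ := 1) (Or.inr rfl) ha'
      (by rwa [pow_one])
    rw [Bireversible.normalForm_one] at h1 h2
    rw [pow_one] at h1
    exact ⟨f none, fun j => f (some j), hf none, fun j => hf (some j), h1, h2⟩
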